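/- Let $k>0$ and $i>0$ be integers, and let $1,\ \delta=\det,\ \varsigma=\operatorname{sgn}(\det)$ be regarded as characters of $GL_k(\mathbb R)$. Let $G=GL_{2k}(\mathbb R)$, and let $P\subset G$ be the subgroup of block upper triangular matrices $p=\begin{pmatrix}a&b\\0&d\end{pmatrix}$ with $a,d\in GL_k(\mathbb R)$, $b\in \mathrm{Mat}_{k\times k}(\mathbb R)$, with modular function $\Delta_P(p)=|\det a|^{k}|\det d|^{-k}$. For characters $\chi_1,\chi_2$ of $GL_k(\mathbb R)$ let $\chi_1\times\chi_2$ denote the representation of $G$ by right translations, $(R_gf)(x)=f(xg)$, on the space of all $f\in C^\infty(G)$ (complex valued) such that $$f(px)=\chi_1(a)\,\chi_2(d)\,\Delta_P(p)^{1/2}f(x)\qquad\text{for all } p=\begin{pmatrix}a&b\\0&d\end{pmatrix}\in P,\ x\in G,$$ with the topology induced by the Fréchet topology of $C^\infty(G)$. For $X\in\mathrm{Mat}_{2k\times 2k}(\mathbb R)$ put $(L_Xf)(x)=\frac{d}{dt}\big|_{t=0}f(\exp(-tX)x)$. For $1\le r,c\le k$ let $E_{rc}$ be the $2k\times 2k$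 matrix whose only nonzero entry is a $1$ in row $k+r$ and column $c$. The $E_{rc}$ span the abelian nilradical opposite to that of $P$, so the operators $L_{E_{rc}}$ commute pairwise; let $$D=\det\big(L_{E_{rc}}\big)_{1\le r,c\le k}=\sum_{\sigma\in S_k}\operatorname{sgn}(\sigma)\prod_{c=1}^kL_{E_{\sigma(c),c}} .$$ Then there is a nonzero intertwining operator $1\times\delta^i\varsigma\to\delta^i\times\varsigma$, i.e. a nonzero continuous $\mathbb C$-linear map commuting with the actions of $G$, and it is given by the differential operator $D^i$: the operator $D^i$ maps $1\times\delta^i\varsigma$ to $\delta^i\times\varsigma$, and its restriction to $1\times\delta^i\varsigma$ is such a map. -/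

import Mathlib

open scoped ContDiff

namespace GrassmannianIntertwiners

noncomputable section

/-! ### Smooth functions on a real general linear group -/

/-- The matrix entries of `g`, as a point of the finite-dimensional normed space `ι → ι → ℝ`. -/
def entries {ι : Type} [Fintype ι] [DecidableEq ι]
    (g : Matrix.GeneralLinearGroup ι ℝ) : ι → ι → ℝ :=
  fun r c => (g : Matrix ι ι ℝ) r c

/-- The extension by zero of a function on the open set `GL(ι, ℝ)` to the space of all matrices. -/
def extendByZero {ι : Type} [Fintype ι] [DecidableEq ι]
    (f : Matrix.GeneralLinearGroup ι ℝ → ℂ) : (ι → ι → ℝ) → ℂ :=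
  Function.extend entries f 0

theorem entries_injective {ι : Type} [Fintype ι] [DecidableEq ι] :
    Function.Injective (entries (ι := ι)) := by
  intro g h hgh
  apply Units.ext
  ext r c
  exact congrFun (congrFun hgh r) c

theorem extendByZero_entries {ι : Type} [Fintype ι] [DecidableEq ι]
    (f : Matrix.GeneralLinearGroup ι ℝ → ℂ) (g : Matrix.GeneralLinearGroup ι ℝ) :
    extendByZero f (entries g) = f g :=
  entries_injective.extend_apply f 0 g

theorem eventually_exists_entries {ι : Type} [Fintype ι] [DecidableEq ι]
    (g : Matrix.GeneralLinearGroup ι ℝ) :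
    ∀ᶠ M in nhds (entries g), ∃ h : Matrix.GeneralLinearGroup ι ℝ, entries h = M := by
  have hc : Continuous (fun M : ι → ι → ℝ => (Matrix.of M).det) :=
    Continuous.matrix_det (continuous_id (X := Matrix ι ι ℝ))
  have hg : (Matrix.of (entries g)).det ≠ 0 :=
    ((Matrix.isUnit_iff_isUnit_det _).1 g.isUnit).ne_zero
  filter_upwards [hc.continuousAt.eventually_ne hg] with M hM
  refine ⟨((Matrix.isUnit_iff_isUnit_det (Matrix.of M)).2 (isUnit_iff_ne_zero.2 hM)).unit, ?_⟩
  rfl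

/-- `C^∞(GL(ι, ℝ))` as a complex vector space of functions: smoothness is taken with respect to
the matrix entries, i.e. for `GL(ι, ℝ)` as an open subset of the space of matrices. -/
def smoothSubmodule (ι : Type) [Fintype ι] [DecidableEq ι] :
    Submodule ℂ (Matrix.GeneralLinearGroup ι ℝ → ℂ) where
  carrier := {f | ∀ g, ContDiffAt ℝ ∞ (extendByZero f) (entries g)}
  zero_mem' := by
    intro g
    have h : extendByZero (0 : Matrix.GeneralLinearGroup ι ℝ → ℂ) = fun _ => 0 := by
      ext M
      simp only [extendByZero, Function.extend]
      split <;> rfl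
    rw [h]
    exact contDiffAt_const
  add_mem' := by
    intro f₁ f₂ h₁ h₂ g
    refine ((h₁ g).add (h₂ g)).congr_of_eventuallyEq ?_
    filter_upwards [eventually_exists_entries g] with M hM
    obtain ⟨h, rfl⟩ := hM
    simp [extendByZero_entries]
  smul_mem' := by
    intro c f hf g
    refine ((contDiffAt_const (c := c)).mul (hf g)).congr_of_eventuallyEq ?_
    filter_upwards [eventually_exists_entries g] with M hM
    obtain ⟨h, rfl⟩ := hM
    simp [extendByZero_entries]

/-- The space `C^∞(GL(ι, ℝ))` of smooth complex-valued functions. It is a type of its own, so that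
it can carry its Fréchet topology (and not the topology of pointwise convergence). -/
def SmoothFun (ι : Type) [Fintype ι] [DecidableEq ι] : Type :=
  ↥(smoothSubmodule ι)

instance (ι : Type) [Fintype ι] [DecidableEq ι] : AddCommGroup (SmoothFun ι) :=
  inferInstanceAs (AddCommGroup ↥(smoothSubmodule ι))

instance (ι : Type) [Fintype ι] [DecidableEq ι] : Module ℂ (SmoothFun ι) :=
  inferInstanceAs (Module ℂ ↥(smoothSubmodule ι))

instance (ι : Type) [Fintype ι] [DecidableEq ι] :
    CoeFun (SmoothFun ι) (fun _ => Matrix.GeneralLinearGroup ι ℝ → ℂ) :=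
  ⟨fun f => f.1⟩

/-- Right translation, `(R_g f)(x) = f (x g)`. -/
def rightTranslate {ι : Type} [Fintype ι] [DecidableEq ι] (g : Matrix.GeneralLinearGroup ι ℝ) :
    SmoothFun ι →ₗ[ℂ] SmoothFun ι where
  toFun f := ⟨fun x => f (x * g), by
    intro x
    have hmul : ContDiff ℝ ∞ (fun M : ι → ι → ℝ => fun r c => ∑ s, M r s * entries g s c) := by
      fun_prop
    have hx : (fun r c => ∑ s, entries x r s * entries g s c) = entries (x * g) := by
      ext r c
      simp [entries, Matrix.mul_apply]
    have hf := f.2 (x * g)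
    rw [← hx] at hf
    refine (ContDiffAt.comp (entries x) hf hmul.contDiffAt).congr_of_eventuallyEq ?_
    filter_upwards [eventually_exists_entries x] with M hM
    obtain ⟨h, rfl⟩ := hM
    have hh : (fun r c => ∑ s, entries h r s * entries g s c) = entries (h * g) := by
      ext r c
      simp [entries, Matrix.mul_apply]
    simp only [Function.comp_apply, hh, extendByZero_entries]⟩
  map_add' _ _ := rfl
  map_smul' _ _ := rfl

/-- The exponential of a matrix, as an element of the general linear group. -/
def expGL {ι : Type} [Fintype ι] [DecidableEq ι] (X : Matrix ι ι ℝ) :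
    Matrix.GeneralLinearGroup ι ℝ :=
  (Matrix.isUnit_exp X).unit

theorem hasDerivAt_exp_entry {ι : Type} [Fintype ι] [DecidableEq ι] (X : Matrix ι ι ℝ)
    (r c : ι) :
    HasDerivAt (fun t : ℝ => (NormedSpace.exp (t • X) : Matrix ι ι ℝ) r c) (X r c) 0 := by
  have h : Filter.Tendsto (slope (fun t : ℝ => (NormedSpace.exp (t • X) : Matrix ι ι ℝ)) 0)
      (nhdsWithin 0 {0}ᶜ) (nhds X) := by
    let _ : NormedRing (Matrix ι ι ℝ) := Matrix.linftyOpNormedRing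
    let _ : NormedAlgebra ℝ (Matrix ι ι ℝ) := Matrix.linftyOpNormedAlgebra
    have _ : CompleteSpace (Matrix ι ι ℝ) := FiniteDimensional.complete ℝ _
    have h1 := hasDerivAt_exp_smul_const (𝕂 := ℝ) X 0
    rw [zero_smul, NormedSpace.exp_zero, one_mul] at h1
    exact h1.tendsto_slope
  rw [hasDerivAt_iff_tendsto_slope]
  have h2 : Continuous (fun M : Matrix ι ι ℝ => M r c) := by fun_prop
  refine ((h2.tendsto X).comp h).congr ?_
  intro t
  simp [slope, Matrix.smul_apply, Matrix.sub_apply]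

theorem hasDerivAt_leftTranslate {ι : Type} [Fintype ι] [DecidableEq ι] (X : Matrix ι ι ℝ)
    (f : SmoothFun ι) (g : Matrix.GeneralLinearGroup ι ℝ) :
    HasDerivAt (fun t : ℝ => f (expGL (-(t • X)) * g))
      (fderiv ℝ (extendByZero f) (entries g)
        (fun r c => ∑ s, (-X) r s * entries g s c)) 0 := by
  have hpath : HasDerivAt (fun t : ℝ => entries (expGL (-(t • X)) * g))
      (fun r c => ∑ s, (-X) r s * entries g s c) 0 := by
    rw [hasDerivAt_pi]
    intro r
    rw [hasDerivAt_pi]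
    intro c
    have h := HasDerivAt.fun_sum (u := Finset.univ) (fun s _ =>
      (hasDerivAt_exp_entry (-X) r s).mul_const (entries g s c))
    refine h.congr_of_eventuallyEq (Filter.Eventually.of_forall fun t => ?_)
    simp [entries, expGL, Matrix.mul_apply]
  have h0 : entries (expGL (-((0 : ℝ) • X)) * g) = entries g := by
    ext r c
    simp [entries, expGL]
  have hF : HasFDerivAt (extendByZero f) (fderiv ℝ (extendByZero f) (entries g))
      (entries (expGL (-((0 : ℝ) • X)) * g)) := by
    rw [h0]
    exact ((f.2 g).differentiableAt (by simp)).hasFDerivAt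
  have h := hF.comp_hasDerivAt (0 : ℝ) hpath
  refine h.congr_of_eventuallyEq (Filter.Eventually.of_forall fun t => ?_)
  simp only [Function.comp_apply, extendByZero_entries]

/-- The derivative of the left regular representation in the direction of a matrix `X` of the
Lie algebra: `(L_X f)(g) = d/dt f (exp (-t X) g)` at `t = 0`. -/
def leftDeriv {ι : Type} [Fintype ι] [DecidableEq ι] (X : Matrix ι ι ℝ) :
    SmoothFun ι →ₗ[ℂ] SmoothFun ι where
  toFun f := ⟨fun g => deriv (fun t : ℝ => f (expGL (-(t • X)) * g)) 0, by
    intro g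
    have h1 : ContDiffAt ℝ ∞ (fderiv ℝ (extendByZero f)) (entries g) :=
      (f.2 g).fderiv_right (by simp)
    have h2 : ContDiff ℝ ∞ (fun M : ι → ι → ℝ => fun r c => ∑ s, (-X) r s * M s c) := by
      fun_prop
    refine (h1.clm_apply h2.contDiffAt).congr_of_eventuallyEq ?_
    filter_upwards [eventually_exists_entries g] with M hM
    obtain ⟨h, rfl⟩ := hM
    rw [extendByZero_entries]
    exact (hasDerivAt_leftTranslate X f h).deriv⟩
  map_add' f₁ f₂ := by
    apply Subtype.ext
    funext g
    exact deriv_fun_add (hasDerivAt_leftTranslate X f₁ g).differentiableAt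
      (hasDerivAt_leftTranslate X f₂ g).differentiableAt
  map_smul' c f := by
    apply Subtype.ext
    funext g
    exact deriv_const_smul c (hasDerivAt_leftTranslate X f g).differentiableAt

/-- The usual Fréchet topology of `C^∞(GL(ι, ℝ))`: uniform convergence on compact sets of
`L_{X₁} ⋯ L_{Xₙ} f` for all finite lists `X₁, …, Xₙ` of elements of the Lie algebra. (The vector
fields `L_X` span the tangent space at every point.) -/
instance (ι : Type) [Fintype ι] [DecidableEq ι] : TopologicalSpace (SmoothFun ι) :=
  ⨅ l : List (Matrix ι ι ℝ), TopologicalSpace.induced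
    (fun f : SmoothFun ι =>
      UniformOnFun.ofFun {K : Set (Matrix.GeneralLinearGroup ι ℝ) | IsCompact K}
        (((l.map leftDeriv).prod : Module.End ℂ (SmoothFun ι)) f :
          Matrix.GeneralLinearGroup ι ℝ → ℂ))
    inferInstance

/-! ### Degenerate principal series -/

/-- The value `|det a| ^ n / |det d| ^ m` of the modular function of the standard block upper
triangular parabolic subgroup, at an element with diagonal blocks `a` (of size `m`) and `d`
(of size `n`). -/
def modularFunction {m n : Type} [Fintype m] [DecidableEq m] [Fintype n] [DecidableEq n]
    (a : Matrix.GeneralLinearGroup m ℝ) (d : Matrix.GeneralLinearGroup n ℝ) : ℝ :=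
  |(a : Matrix m m ℝ).det| ^ Fintype.card n / |(d : Matrix n n ℝ).det| ^ Fintype.card m

/-- The space of the (normalized) induced representation `χ₁ × χ₂`: smooth `f` on `GL(m ⊕ n, ℝ)`
with `f (p x) = χ₁(a) χ₂(d) Δ(p)^{1/2} f x` for every `p` with blocks `a, b, 0, d`. -/
def principalSeries {m n : Type} [Fintype m] [DecidableEq m] [Fintype n] [DecidableEq n]
    (χ₁ : Matrix.GeneralLinearGroup m ℝ →* ℂˣ) (χ₂ : Matrix.GeneralLinearGroup n ℝ →* ℂˣ) :
    Submodule ℂ (SmoothFun (m ⊕ n)) where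
  carrier := {f | ∀ (p : Matrix.GeneralLinearGroup (m ⊕ n) ℝ)
    (a : Matrix.GeneralLinearGroup m ℝ) (b : Matrix m n ℝ) (d : Matrix.GeneralLinearGroup n ℝ),
    (p : Matrix (m ⊕ n) (m ⊕ n) ℝ) = Matrix.fromBlocks a b 0 d →
    ∀ x, f (p * x) = (χ₁ a : ℂ) * (χ₂ d : ℂ) * (Real.sqrt (modularFunction a d) : ℂ) * f x}
  zero_mem' := by
    intro p a b d _ x
    exact (mul_zero _).symm
  add_mem' := by
    intro f₁ f₂ h₁ h₂ p a b d hp x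
    have e₁ := h₁ p a b d hp x
    have e₂ := h₂ p a b d hp x
    change f₁ (p * x) + f₂ (p * x) = _ * (f₁ x + f₂ x)
    rw [e₁, e₂, mul_add]
  smul_mem' := by
    intro c f hf p a b d hp x
    have e := hf p a b d hp x
    change c * f (p * x) = _ * (c * f x)
    rw [e]
    ring

/-- The action of `GL(m ⊕ n, ℝ)` on `χ₁ × χ₂` by right translations. -/
def principalSeriesRep {m n : Type} [Fintype m] [DecidableEq m] [Fintype n] [DecidableEq n]
    (χ₁ : Matrix.GeneralLinearGroup m ℝ →* ℂˣ) (χ₂ : Matrix.GeneralLinearGroup n ℝ →* ℂˣ) :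
    Representation ℂ (Matrix.GeneralLinearGroup (m ⊕ n) ℝ) ↥(principalSeries χ₁ χ₂) where
  toFun g := (rightTranslate g).restrict (by
    intro f hf p a b d hp x
    change f (p * x * g) = _ * f (x * g)
    rw [mul_assoc]
    exact hf p a b d hp (x * g))
  map_one' := by
    apply LinearMap.ext
    intro f
    apply Subtype.ext
    apply Subtype.ext
    funext x
    change f.1 (x * 1) = f.1 x
    rw [mul_one]
  map_mul' g h := by
    apply LinearMap.ext
    intro f
    apply Subtype.ext
    apply Subtype.ext
    funext x
    change f.1 (x * (g * h)) = f.1 (x * g * h)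
    rw [mul_assoc]

/-! ### The characters `δ` and `ς` -/

/-- The character `δ = det` of `GL(ι, ℝ)`. -/
def detChar (ι : Type) [Fintype ι] [DecidableEq ι] : Matrix.GeneralLinearGroup ι ℝ →* ℂˣ :=
  (Units.map (algebraMap ℝ ℂ : ℝ →* ℂ)).comp Matrix.GeneralLinearGroup.det

/-- The character `ς = sgn(det)` of `GL(ι, ℝ)`. -/
def signChar (ι : Type) [Fintype ι] [DecidableEq ι] : Matrix.GeneralLinearGroup ι ℝ →* ℂˣ :=
  (Units.map ((SignType.castHom : SignType →*₀ ℂ).comp (signHom : ℝ →*₀ SignType) : ℝ →* ℂ)).comp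
    Matrix.GeneralLinearGroup.det

/-! ### The differential operator attached to `det ^ i` -/

/-- The matrix unit of the opposite nilradical (the lower left `k × k` blocks) whose only nonzero
entry is in row `r` and column `c` of the lower left block. -/
def lowerUnit (k : ℕ) (r c : Fin k) : Matrix (Fin k ⊕ Fin k) (Fin k ⊕ Fin k) ℝ :=
  Matrix.single (Sum.inr r) (Sum.inl c) 1

/-- The determinant (Leibniz formula) of the `k × k` matrix of the pairwise commuting operators
`L_E`, where `E` runs through the matrix units of the opposite nilradical. This is `L_u` for the
`u` in the enveloping algebra (= symmetric algebra) of the opposite nilradical that corresponds to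
the polynomial `det` on the nilradical under the trace pairing. -/
def detOperator (k : ℕ) : Module.End ℂ (SmoothFun (Fin k ⊕ Fin k)) :=
  ∑ σ : Equiv.Perm (Fin k), ((Equiv.Perm.sign σ : ℤ) : ℂ) •
    (List.ofFn fun c : Fin k => (leftDeriv (lowerUnit k (σ c) c) :
      Module.End ℂ (SmoothFun (Fin k ⊕ Fin k)))).prod

end

end GrassmannianIntertwiners

/-!
Right translations commute with the left derivatives `L_X`, so what has to be shown is that `D ^ i`
maps `1 × δ ^ i ς` to functions which transform correctly under left translation by the parabolic
subgroup, that `D ^ i` is continuous, and that it does not vanish on `1 × δ ^ i ς`.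

*Equivariance.* The derivatives along the opposite nilradical commute, hence extend to a homomorphism
`Ψ` from polynomials in `k × k` variables to operators, and `D = Ψ det`. The Levi subgroup acts on
these variables by `X ↦ d⁻ᵀ X aᵀ`, hence on `det` by `det a / det d`
(`leftTranslate_leviElement_detOperator`); this is the change of the inducing characters. For the
unipotent radical it is enough that its Lie algebra kills `D ^ i f`
(`apply_mul_eq_of_leftDeriv_eq_zero`). For `f` in `1 × δ ^ i ς`, commutation of a matrix unit `U_st`
of the nilradical past the variables shows that it acts on the vectors `Ψ Q f` through the operator
`Q ↦ (i - k) ∂_ts Q - ∑ X_pq ∂_ps ∂_tq Q` on polynomials. That this operator kills `det ^ i` is an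
identity between cofactors of the generic matrix (`sum_X_mul_pderiv_pderiv_det_pow`); the number
`i - k` comes from the inducing character together with the square root of the modular function.

*Continuity* is built into the topology, which is defined by iterated left derivatives.

*Non-vanishing.* An explicit `f = τ ^ (k i) v` in `1 × δ ^ i ς` is tested at the identity, with `τ`
vanishing there and having the trace as its derivative along the opposite nilradical. Each left
derivative lowers the power of `τ` by one, so that only the derivatives of `τ` itself contribute to
`D ^ i f` at `1`, which is `(k i)! det (-1) ^ i v 1`.
-/

namespace GrassmannianIntertwiners

noncomputable section

/-! ### Constant-coefficient operators and the generic determinant -/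

/-- Pairwise commuting operators extend to an algebra homomorphism from polynomials, although the
algebra of all operators is not commutative (so that `MvPolynomial.aeval` is not available). -/
theorem exists_algHom_of_commute {σ R A : Type*} [CommRing R] [Ring A] [Algebra R A]
    (x : σ → A) (hx : ∀ s t, Commute (x s) (x t)) :
    ∃ Ψ : MvPolynomial σ R →ₐ[R] A, ∀ s, Ψ (MvPolynomial.X s) = x s := by
  have hc : IsMulCommutative (Algebra.adjoin R (Set.range x)) := by
    refine Algebra.isMulCommutative_adjoin R ?_
    rintro _ ⟨s, rfl⟩ _ ⟨t, rfl⟩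
    exact hx s t
  let _ : CommRing (Algebra.adjoin R (Set.range x)) :=
    { (Algebra.adjoin R (Set.range x)).toRing with mul_comm := hc.is_comm.comm }
  refine ⟨(Algebra.adjoin R (Set.range x)).val.comp
    (MvPolynomial.aeval fun s => ⟨x s, Algebra.subset_adjoin ⟨s, rfl⟩⟩), fun s => ?_⟩
  rw [AlgHom.comp_apply, MvPolynomial.aeval_X]
  rfl

section GenericDeterminant

open MvPolynomial Matrix

variable {n R : Type*} [Fintype n] [DecidableEq n] [CommRing R]

theorem derivation_det_eq_zero {A : Type*} [CommRing A] [Algebra R A]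
    (D : Derivation R A A) (M : Matrix n n A) (hM : ∀ i j, D (M i j) = 0) : D M.det = 0 := by
  have hprod : ∀ (s : Finset n) (g : n → A), (∀ j ∈ s, D (g j) = 0) → D (∏ j ∈ s, g j) = 0 := by
    intro s g
    induction s using Finset.induction_on with
    | empty => simp
    | insert a s ha ih =>
      intro h
      rw [Finset.prod_insert ha, D.leibniz, ih fun j hj => h j (Finset.mem_insert_of_mem hj),
        h a (Finset.mem_insert_self a s)]
      simp
  rw [Matrix.det_apply, map_sum]
  refine Finset.sum_eq_zero fun σ _ => ?_
  rw [Units.smul_def, map_zsmul, hprod _ _ fun j _ => hM _ _, smul_zero]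

/-- The partial derivatives of the generic determinant are its cofactors. -/
theorem pderiv_det_mvPolynomialX (r c : n) :
    pderiv (r, c) (mvPolynomialX n n R).det = (mvPolynomialX n n R).adjugate c r := by
  rw [Matrix.det_eq_sum_mul_adjugate_row _ r, map_sum]
  have h0 : ∀ j, pderiv (r, c) ((mvPolynomialX n n R).adjugate j r) = 0 := by
    intro j
    rw [Matrix.adjugate_apply]
    refine derivation_det_eq_zero _ _ fun a b => ?_
    rcases eq_or_ne a r with rfl | ha
    · rw [Matrix.updateRow_self]
      rcases eq_or_ne b j with rfl | hb
      · simp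
      · simp [hb]
    · rw [Matrix.updateRow_ne ha, mvPolynomialX_apply, pderiv_X_of_ne]
      exact fun h => ha (congrArg Prod.fst h)
  rw [Finset.sum_eq_single c]
  · rw [Derivation.leibniz, h0, mvPolynomialX_apply, pderiv_X_self]
    simp
  · intro j _ hj
    rw [Derivation.leibniz, h0, mvPolynomialX_apply, pderiv_X_of_ne]
    · simp
    · exact fun h => hj (congrArg Prod.snd h)
  · simp

/-- The second derivatives of the generic determinant, as `2 × 2` minors of the adjugate. This is
the derivative of `X * adj X = det X`, multiplied by `adj X` from the left. -/
theorem det_mul_pderiv_adjugate (p s c t : n) :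
    (mvPolynomialX n n R).det * pderiv (p, s) ((mvPolynomialX n n R).adjugate c t) =
      (mvPolynomialX n n R).adjugate s p * (mvPolynomialX n n R).adjugate c t -
        (mvPolynomialX n n R).adjugate c p * (mvPolynomialX n n R).adjugate s t := by
  set X := mvPolynomialX n n R with hX
  set A := X.adjugate with hA
  have hdX : X.map (pderiv (p, s)) = Matrix.single p s 1 := by
    ext1 a b
    rw [Matrix.map_apply, hX, mvPolynomialX_apply, pderiv_X, Matrix.single_apply]
    simp [Pi.single_apply, Prod.ext_iff, eq_comm]
  have h1 : Matrix.single p s 1 * A + X * A.map (pderiv (p, s)) = A s p • 1 := by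
    ext1 a b
    have h : (X * A) a b = (X.det • (1 : Matrix n n (MvPolynomial (n × n) R))) a b := by
      rw [hA, Matrix.mul_adjugate]
    have h' := congrArg (pderiv (p, s)) h
    rw [Matrix.mul_apply, map_sum, Matrix.smul_apply, smul_eq_mul, Derivation.leibniz,
      hX, pderiv_det_mvPolynomialX, ← hX, ← hA] at h'
    have h1 : pderiv (p, s) ((1 : Matrix n n (MvPolynomial (n × n) R)) a b) = 0 := by
      rw [Matrix.one_apply]
      split_ifs <;> simp
    rw [h1, smul_zero, zero_add, smul_eq_mul] at h'
    rw [Matrix.smul_apply, smul_eq_mul, mul_comm, ← h', ← hdX, Matrix.add_apply,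
      Matrix.mul_apply, Matrix.mul_apply, ← Finset.sum_add_distrib]
    refine Finset.sum_congr rfl fun j _ => ?_
    rw [Derivation.leibniz, Matrix.map_apply, Matrix.map_apply, smul_eq_mul, smul_eq_mul]
    ring
  have h2 : A * Matrix.single p s 1 * A + X.det • A.map (pderiv (p, s)) = A s p • A := by
    have := congrArg (fun N => A * N) h1
    simp only [Matrix.mul_add, ← Matrix.mul_assoc] at this
    rw [show A * X = X.det • 1 from Matrix.adjugate_mul X] at this
    simpa using this
  have h3 := congrFun (congrFun h2 c) t
  have h4 : (A * Matrix.single p s 1 * A : Matrix n n (MvPolynomial (n × n) R)) c t =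
      A c p * A s t := by
    rw [Matrix.mul_apply, Finset.sum_eq_single s]
    · simp
    · intro b _ hb
      rw [Matrix.mul_single_apply_of_ne _ _ _ _ _ hb, zero_mul]
    · simp
  rw [Matrix.add_apply, h4, Matrix.smul_apply, Matrix.smul_apply, smul_eq_mul, smul_eq_mul,
    Matrix.map_apply] at h3
  rw [← h3]
  ring

/-- The identity behind the intertwining property: a second-order operator of this shape maps
`det ^ i` to `i - n` times a first derivative of it. -/
theorem sum_X_mul_pderiv_pderiv_det_pow [IsDomain R] (i : ℕ) (s t : n) :
    ∑ p, ∑ q, X (p, q) * pderiv (p, s) (pderiv (t, q) ((mvPolynomialX n n R).det ^ i)) =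
      ((i : MvPolynomial (n × n) R) - (Fintype.card n : MvPolynomial (n × n) R)) *
        pderiv (t, s) ((mvPolynomialX n n R).det ^ i) := by
  cases i with
  | zero => simp
  | succ j =>
    set X' := mvPolynomialX n n R with hX
    set A := X'.adjugate with hA
    have hfirst : ∀ q : n, pderiv (t, q) (X'.det ^ (j + 1)) = (j + 1) * X'.det ^ j * A q t := by
      intro q
      rw [Derivation.leibniz_pow, hX, pderiv_det_mvPolynomialX, ← hX, ← hA]
      simp only [Nat.add_sub_cancel, nsmul_eq_mul, smul_eq_mul]
      push_cast
      ring
    have hsecond : ∀ p q : n, X'.det * pderiv (p, s) (pderiv (t, q) (X'.det ^ (j + 1))) =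
        (j + 1) * X'.det ^ j * ((j + 1) * (A s p * A q t) - A q p * A s t) := by
      intro p q
      have hpow : X'.det * pderiv (p, s) (X'.det ^ j) = j * X'.det ^ j * A s p := by
        cases j with
        | zero => simp
        | succ l =>
          rw [Derivation.leibniz_pow, hX, pderiv_det_mvPolynomialX, ← hX, ← hA]
          simp only [Nat.add_sub_cancel, nsmul_eq_mul, smul_eq_mul]
          push_cast
          ring
      have hadj := det_mul_pderiv_adjugate (R := R) p s q t
      rw [← hX, ← hA] at hadj
      have hc : pderiv (p, s) ((j : MvPolynomial (n × n) R) + 1) = 0 := by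
        exact_mod_cast (pderiv (R := R) (p, s)).map_natCast (j + 1)
      rw [hfirst, Derivation.leibniz, Derivation.leibniz, hc]
      simp only [smul_eq_mul, mul_zero, add_zero]
      linear_combination ((j : MvPolynomial (n × n) R) + 1) * A q t * hpow +
        ((j : MvPolynomial (n × n) R) + 1) * X'.det ^ j * hadj
    have hsum1 : ∑ p, ∑ q, X (p, q) * (A s p * A q t) = X'.det * A s t := by
      have h : (A * X' * A) s t = X'.det * A s t := by
        rw [hA, Matrix.adjugate_mul]
        simp
      rw [← h, Matrix.mul_apply, Finset.sum_comm]
      refine Finset.sum_congr rfl fun q _ => ?_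
      rw [Matrix.mul_apply, Finset.sum_mul]
      refine Finset.sum_congr rfl fun p _ => ?_
      rw [hX, mvPolynomialX_apply]
      ring
    have hsum2 : ∑ p, ∑ q, X (p, q) * A q p = Fintype.card n * X'.det := by
      have h : (X' * A).trace = Fintype.card n * X'.det := by
        rw [hA, Matrix.mul_adjugate]
        simp [mul_comm]
      rw [← h, Matrix.trace]
      refine Finset.sum_congr rfl fun p _ => ?_
      rw [Matrix.diag_apply, Matrix.mul_apply]
      rfl
    -- After multiplication by `det`, both sides are polynomials in `det` and the cofactors.
    apply mul_left_cancel₀ (show X'.det ≠ 0 from det_mvPolynomialX_ne_zero n R)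
    calc X'.det * ∑ p, ∑ q, X (p, q) * pderiv (p, s) (pderiv (t, q) (X'.det ^ (j + 1)))
        = ∑ p, ∑ q, X (p, q) * (X'.det * pderiv (p, s) (pderiv (t, q) (X'.det ^ (j + 1)))) := by
          simp only [Finset.mul_sum]
          refine Finset.sum_congr rfl fun p _ => Finset.sum_congr rfl fun q _ => ?_
          ring
      _ = (j + 1) * X'.det ^ j * ((j + 1) * ∑ p, ∑ q, X (p, q) * (A s p * A q t) -
            A s t * ∑ p, ∑ q, X (p, q) * A q p) := by
          simp only [hsecond, Finset.mul_sum, ← Finset.sum_sub_distrib]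
          refine Finset.sum_congr rfl fun p _ => Finset.sum_congr rfl fun q _ => ?_
          ring
      _ = _ := by
          rw [hsum1, hsum2, hfirst]
          push_cast
          ring

end GenericDeterminant

section HighestWeight

open MvPolynomial

variable {k : ℕ} {V : Type*} [AddCommGroup V] [Module ℂ V]

theorem pderiv_X_mul {n R : Type*} [DecidableEq n] [CommRing R] (a b r c : n)
    (P : MvPolynomial (n × n) R) : pderiv (a, b) (X (r, c) * P) =
      (if a = r then (if c = b then P else 0) else 0) + X (r, c) * pderiv (a, b) P := by
  rw [Derivation.leibniz, pderiv_X, Pi.single_apply, smul_eq_mul, smul_eq_mul, add_comm]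
  congr 1
  split_ifs <;> simp_all

theorem sum_X_mul_pderiv_pderiv_X_mul {n R : Type*} [Fintype n] [DecidableEq n] [CommRing R]
    (s t r c : n) (Q : MvPolynomial (n × n) R) :
    ∑ p, ∑ q, X (p, q) * pderiv (p, s) (pderiv (t, q) (X (r, c) * Q)) =
      (if t = r then ∑ p, X (p, c) * pderiv (p, s) Q else 0) +
      (if c = s then ∑ q, X (r, q) * pderiv (t, q) Q else 0) +
      X (r, c) * ∑ p, ∑ q, X (p, q) * pderiv (p, s) (pderiv (t, q) Q) := by
  have hterm : ∀ p q, X (p, q) * pderiv (p, s) (pderiv (t, q) (X (r, c) * Q)) =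
      (if c = q then (if t = r then X (p, c) * pderiv (p, s) Q else 0) else 0) +
      (if p = r then (if c = s then X (r, q) * pderiv (t, q) Q else 0) else 0) +
      X (r, c) * (X (p, q) * pderiv (p, s) (pderiv (t, q) Q)) := by
    intro p q
    rw [pderiv_X_mul, map_add, pderiv_X_mul]
    split_ifs <;> (try simp only [map_zero]) <;> subst_vars <;> ring
  simp only [hterm, Finset.sum_add_distrib, Finset.mul_sum, Finset.sum_ite_eq,
    Finset.mem_univ, if_true]
  congr 2
  · split_ifs <;> simp
  · rw [Finset.sum_comm]
    simp only [Finset.sum_ite_eq', Finset.mem_univ, if_true]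
    split_ifs <;> simp

theorem sum_derivation_apply {ι R A : Type*} [CommRing R] [CommRing A] [Algebra R A]
    (s : Finset ι) (D : ι → Derivation R A A) (a : A) : (∑ j ∈ s, D j) a = ∑ j ∈ s, D j a := by
  induction s using Finset.cons_induction with
  | empty => simp
  | cons j s hj ih => rw [Finset.sum_cons, Finset.sum_cons, Derivation.add_apply, ih]

/-- If the commutators of `T` with the operators `Ψ (X v)` are given by a derivation `D`, and `f` is
an eigenvector of `T` with eigenvalue `c`, then `T` acts on the vectors `Ψ Q f` through
`Q ↦ c Q + D Q`. -/
theorem apply_algHom_apply_of_derivation {σ : Type*} (Ψ : MvPolynomial σ ℂ →ₐ[ℂ] Module.End ℂ V)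
    (T : Module.End ℂ V) (D : Derivation ℂ (MvPolynomial σ ℂ) (MvPolynomial σ ℂ))
    (hT : ∀ v, T * Ψ (X v) = Ψ (X v) * T + Ψ (D (X v))) {c : ℂ} {f : V} (hf : T f = c • f)
    (Q : MvPolynomial σ ℂ) : T (Ψ Q f) = Ψ (C c * Q + D Q) f := by
  have hC : ∀ a : ℂ, Ψ (C a) = algebraMap ℂ _ a := Ψ.commutes
  induction Q using MvPolynomial.induction_on with
  | C a =>
    rw [show D (C a) = 0 from D.map_algebraMap a, add_zero, map_mul, hC, hC]
    simp only [Module.End.mul_apply, Module.algebraMap_end_apply, map_smul, hf]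
  | add p q hp hq =>
    rw [map_add, LinearMap.add_apply, map_add, hp, hq, ← LinearMap.add_apply, ← map_add, D.map_add]
    congr 2
    ring
  | mul_X Q v hQ =>
    rw [mul_comm Q, map_mul, Module.End.mul_apply, ← Module.End.mul_apply, hT,
      LinearMap.add_apply, Module.End.mul_apply, hQ, ← Module.End.mul_apply, ← Module.End.mul_apply,
      ← map_mul, ← map_mul, ← LinearMap.add_apply, ← map_add, D.leibniz]
    congr 2
    simp only [smul_eq_mul]
    ring

/-- The algebraic form of the intertwining property. The operators `Ψ (X (r, c))`, `A`, `B`, `U`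
satisfy the relations of the matrix units in the lower left, upper left, lower right and upper right
blocks. If `U` kills `f`, and `A`, `B` act on it as on the functions of the induced representation
`1 × δ ^ i ς`, then `U` also kills `det (Ψ X) ^ i f`: on the vectors `Ψ Q f`, it acts through a
second-order differential operator on the polynomials `Q`, and this operator kills `det ^ i`. -/
theorem upper_apply_det_pow_eq_zero
    (Ψ : MvPolynomial (Fin k × Fin k) ℂ →ₐ[ℂ] Module.End ℂ V)
    (A B U : Fin k → Fin k → Module.End ℂ V) (i : ℕ) (f : V)
    (hAX : ∀ s c p q, A s c * Ψ (X (p, q)) =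
      Ψ (X (p, q)) * A s c - if q = s then Ψ (X (p, c)) else 0)
    (hBX : ∀ r t p q, B r t * Ψ (X (p, q)) =
      Ψ (X (p, q)) * B r t + if t = p then Ψ (X (r, q)) else 0)
    (hUX : ∀ s t r c, U s t * Ψ (X (r, c)) =
      Ψ (X (r, c)) * U s t + (if t = r then A s c else 0) - if c = s then B r t else 0)
    (hAf : ∀ s c, A s c f = (if c = s then -(k / 2 : ℂ) else 0) • f)
    (hBf : ∀ r t, B r t f = (if t = r then -(i - k / 2 : ℂ) else 0) • f)
    (hUf : ∀ s t, U s t f = 0) (s t : Fin k) :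
    U s t (Ψ ((Matrix.mvPolynomialX (Fin k) (Fin k) ℂ).det ^ i) f) = 0 := by
  have hA : ∀ (s c : Fin k) (Q : MvPolynomial (Fin k × Fin k) ℂ), A s c (Ψ Q f) =
      Ψ (C (if c = s then -(k / 2 : ℂ) else 0) * Q - ∑ p, X (p, c) * pderiv (p, s) Q) f := by
    intro s c Q
    have h := apply_algHom_apply_of_derivation Ψ (A s c)
      (-∑ p, (X (p, c) : MvPolynomial (Fin k × Fin k) ℂ) • pderiv (p, s)) ?_ (hAf s c) Q
    · simpa [sum_derivation_apply, sub_eq_add_neg] using h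
    · rintro ⟨p, q⟩
      rw [hAX, sub_eq_add_neg]
      congr 1
      by_cases h : q = s
      · subst h
        simp [sum_derivation_apply, pderiv_X, Pi.single_apply]
      · simp [sum_derivation_apply, pderiv_X, h]
  have hB : ∀ (r t : Fin k) (Q : MvPolynomial (Fin k × Fin k) ℂ), B r t (Ψ Q f) =
      Ψ (C (if t = r then -(i - k / 2 : ℂ) else 0) * Q + ∑ q, X (r, q) * pderiv (t, q) Q) f := by
    intro r t Q
    have h := apply_algHom_apply_of_derivation Ψ (B r t)
      (∑ q, (X (r, q) : MvPolynomial (Fin k × Fin k) ℂ) • pderiv (t, q)) ?_ (hBf r t) Q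
    · simpa [sum_derivation_apply] using h
    · rintro ⟨p, q⟩
      rw [hBX]
      congr 1
      by_cases h : t = p
      · subst h
        simp [sum_derivation_apply, pderiv_X, Pi.single_apply]
      · simp [sum_derivation_apply, pderiv_X, h, Ne.symm h]
  have hU : ∀ Q : MvPolynomial (Fin k × Fin k) ℂ, U s t (Ψ Q f) =
      Ψ (C (i - k : ℂ) * pderiv (t, s) Q -
        ∑ p, ∑ q, X (p, q) * pderiv (p, s) (pderiv (t, q) Q)) f := by
    intro Q
    induction Q using MvPolynomial.induction_on with
    | C a =>
      rw [show Ψ (C a) = algebraMap ℂ _ a from Ψ.commutes a]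
      simp [hUf]
    | add p q hp hq =>
      rw [map_add, LinearMap.add_apply, map_add, hp, hq, ← LinearMap.add_apply, ← map_add]
      congr 2
      simp only [map_add, mul_add, Finset.sum_add_distrib]
      ring
    | mul_X Q v hQ =>
      obtain ⟨r, c⟩ := v
      have h1 : (if t = r then A s c else 0) (Ψ Q f) =
          Ψ (if t = r then C (if c = s then -(k / 2 : ℂ) else 0) * Q -
            ∑ p, X (p, c) * pderiv (p, s) Q else 0) f := by
        split_ifs with h
        · simp [*]
        · simp [*]
        · simp
      have h2 : (if c = s then B r t else 0) (Ψ Q f) =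
          Ψ (if c = s then C (if t = r then -(i - k / 2 : ℂ) else 0) * Q +
            ∑ q, X (r, q) * pderiv (t, q) Q else 0) f := by
        split_ifs with h
        · simp [*]
        · simp [*]
        · simp
      rw [mul_comm Q, map_mul, Module.End.mul_apply, ← Module.End.mul_apply, hUX,
        LinearMap.sub_apply, LinearMap.add_apply, Module.End.mul_apply, hQ, h1, h2,
        ← Module.End.mul_apply, ← map_mul, ← LinearMap.add_apply, ← map_add,
        ← LinearMap.sub_apply, ← map_sub]
      congr 2
      rw [sum_X_mul_pderiv_pderiv_X_mul, pderiv_X_mul]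
      rw [show (i - k : ℂ) = i - k / 2 - k / 2 by ring]
      generalize (k / 2 : ℂ) = κ
      split_ifs <;> simp only [map_sub, map_neg, map_zero] <;> ring
  rw [hU, sum_X_mul_pderiv_pderiv_det_pow]
  simp

end HighestWeight

/-! ### Left derivatives -/

section LeftDeriv

variable {ι : Type} [Fintype ι] [DecidableEq ι]

theorem SmoothFun.ext {f h : SmoothFun ι} (H : ∀ g, f g = h g) : f = h :=
  Subtype.ext (funext H)

theorem SmoothFun.add_apply (f h : SmoothFun ι) (g : Matrix.GeneralLinearGroup ι ℝ) :
    (f + h) g = f g + h g := rfl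

theorem SmoothFun.smul_apply (c : ℂ) (f : SmoothFun ι) (g : Matrix.GeneralLinearGroup ι ℝ) :
    (c • f) g = c * f g := rfl

/-- Left multiplication by a matrix, on the space of matrix entries. -/
def mulLeftEntries (X : Matrix ι ι ℝ) : (ι → ι → ℝ) →L[ℝ] (ι → ι → ℝ) where
  toFun M := fun r c => ∑ s, X r s * M s c
  map_add' M N := by
    funext r c
    simp [mul_add, Finset.sum_add_distrib]
  map_smul' a M := by
    funext r c
    simp only [Pi.smul_apply, smul_eq_mul, RingHom.id_apply, Finset.mul_sum]
    exact Finset.sum_congr rfl fun _ _ => mul_left_comm _ _ _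
  cont := by fun_prop

theorem of_mulLeftEntries (X : Matrix ι ι ℝ) (M : ι → ι → ℝ) :
    Matrix.of (mulLeftEntries X M) = X * Matrix.of M := by
  ext r c
  rw [Matrix.mul_apply]
  rfl

theorem mulLeftEntries_mulLeftEntries (X Y : Matrix ι ι ℝ) (M : ι → ι → ℝ) :
    mulLeftEntries X (mulLeftEntries Y M) = mulLeftEntries (X * Y) M := by
  apply Matrix.of.injective
  rw [of_mulLeftEntries, of_mulLeftEntries, of_mulLeftEntries, Matrix.mul_assoc]

theorem mulLeftEntries_add (X Y : Matrix ι ι ℝ) (M : ι → ι → ℝ) :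
    mulLeftEntries (X + Y) M = mulLeftEntries X M + mulLeftEntries Y M := by
  apply Matrix.of.injective
  rw [of_mulLeftEntries, add_mul, ← of_mulLeftEntries, ← of_mulLeftEntries]
  rfl

theorem mulLeftEntries_smul (a : ℝ) (X : Matrix ι ι ℝ) (M : ι → ι → ℝ) :
    mulLeftEntries (a • X) M = a • mulLeftEntries X M := by
  apply Matrix.of.injective
  rw [of_mulLeftEntries, Matrix.smul_mul, ← of_mulLeftEntries]
  rfl

theorem mulLeftEntries_sub (X Y : Matrix ι ι ℝ) (M : ι → ι → ℝ) :
    mulLeftEntries (X - Y) M = mulLeftEntries X M - mulLeftEntries Y M := by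
  apply Matrix.of.injective
  rw [of_mulLeftEntries, sub_mul, ← of_mulLeftEntries, ← of_mulLeftEntries]
  rfl

theorem mulLeftEntries_one (M : ι → ι → ℝ) : mulLeftEntries 1 M = M := by
  apply Matrix.of.injective
  rw [of_mulLeftEntries, one_mul]

theorem entries_mul (p g : Matrix.GeneralLinearGroup ι ℝ) :
    entries (p * g) = mulLeftEntries (p : Matrix ι ι ℝ) (entries g) := by
  apply Matrix.of.injective
  rw [of_mulLeftEntries]
  rfl

theorem leftDeriv_apply (X : Matrix ι ι ℝ) (f : SmoothFun ι)
    (g : Matrix.GeneralLinearGroup ι ℝ) :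
    leftDeriv X f g = fderiv ℝ (extendByZero f) (entries g) (mulLeftEntries (-X) (entries g)) :=
  (hasDerivAt_leftTranslate X f g).deriv

theorem leftDeriv_add (X Y : Matrix ι ι ℝ) : leftDeriv (X + Y) = leftDeriv X + leftDeriv Y := by
  refine LinearMap.ext fun f => SmoothFun.ext fun g => ?_
  rw [LinearMap.add_apply, SmoothFun.add_apply, leftDeriv_apply, leftDeriv_apply, leftDeriv_apply,
    neg_add, mulLeftEntries_add, map_add]

theorem leftDeriv_smul (c : ℝ) (X : Matrix ι ι ℝ) : leftDeriv (c • X) = (c : ℂ) • leftDeriv X := by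
  refine LinearMap.ext fun f => SmoothFun.ext fun g => ?_
  rw [LinearMap.smul_apply, SmoothFun.smul_apply, leftDeriv_apply, leftDeriv_apply, ← smul_neg,
    ← Complex.real_smul, ← map_smul, ← mulLeftEntries_smul]

theorem leftDeriv_zero : leftDeriv (0 : Matrix ι ι ℝ) = 0 := by
  simpa using leftDeriv_smul 0 (0 : Matrix ι ι ℝ)

theorem leftDeriv_sum {α : Type*} (s : Finset α) (X : α → Matrix ι ι ℝ) :
    leftDeriv (∑ j ∈ s, X j) = ∑ j ∈ s, leftDeriv (X j) := by
  induction s using Finset.cons_induction with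
  | empty => simpa using leftDeriv_zero
  | cons j s hj ih => rw [Finset.sum_cons, Finset.sum_cons, leftDeriv_add, ih]

theorem extendByZero_leftDeriv (X : Matrix ι ι ℝ) (f : SmoothFun ι)
    (g : Matrix.GeneralLinearGroup ι ℝ) :
    extendByZero (leftDeriv X f) =ᶠ[nhds (entries g)]
      fun M => fderiv ℝ (extendByZero f) M (mulLeftEntries (-X) M) := by
  filter_upwards [eventually_exists_entries g] with M hM
  obtain ⟨h, rfl⟩ := hM
  rw [extendByZero_entries, leftDeriv_apply]

theorem leftDeriv_mul_apply (X Y : Matrix ι ι ℝ) (f : SmoothFun ι)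
    (g : Matrix.GeneralLinearGroup ι ℝ) :
    leftDeriv X (leftDeriv Y f) g =
      fderiv ℝ (fderiv ℝ (extendByZero f)) (entries g) (mulLeftEntries (-X) (entries g))
        (mulLeftEntries (-Y) (entries g)) +
      fderiv ℝ (extendByZero f) (entries g) (mulLeftEntries (Y * X) (entries g)) := by
  have h1 : ContDiffAt ℝ ∞ (fderiv ℝ (extendByZero f)) (entries g) :=
    (f.2 g).fderiv_right (by simp)
  have h2 : HasFDerivAt (fderiv ℝ (extendByZero f))
      (fderiv ℝ (fderiv ℝ (extendByZero f)) (entries g)) (entries g) :=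
    (h1.differentiableAt (by simp)).hasFDerivAt
  have h3 := h2.clm_apply (mulLeftEntries (-Y)).hasFDerivAt
  rw [leftDeriv_apply, (extendByZero_leftDeriv Y f g).fderiv_eq, h3.fderiv]
  simp only [add_apply, ContinuousLinearMap.comp_apply,
    ContinuousLinearMap.flip_apply, mulLeftEntries_mulLeftEntries, neg_mul_neg]
  rw [add_comm]

/-- `X ↦ L_X` is a homomorphism of Lie algebras: the second-order terms cancel by the symmetry of the
second derivative. -/
theorem leftDeriv_mul_sub_mul (X Y : Matrix ι ι ℝ) :
    (leftDeriv X * leftDeriv Y - leftDeriv Y * leftDeriv X : Module.End ℂ (SmoothFun ι)) =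
      leftDeriv (X * Y - Y * X) := by
  refine sub_eq_of_eq_add (LinearMap.ext fun f => SmoothFun.ext fun g => ?_)
  have hs : IsSymmSndFDerivAt ℝ (extendByZero f) (entries g) :=
    (f.2 g).isSymmSndFDerivAt (by simpa using WithTop.coe_le_coe.2 (le_top (a := (2 : ℕ∞))))
  rw [LinearMap.add_apply, SmoothFun.add_apply, Module.End.mul_apply, Module.End.mul_apply,
    leftDeriv_mul_apply, leftDeriv_mul_apply, leftDeriv_apply, hs.eq, neg_sub,
    mulLeftEntries_sub, map_sub]
  ring

/-- Left translation, `f ↦ (x ↦ f (m x))`. -/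
def leftTranslate (m : Matrix.GeneralLinearGroup ι ℝ) : SmoothFun ι →ₗ[ℂ] SmoothFun ι where
  toFun f := ⟨fun x => f (m * x), by
    intro x
    have hf := f.2 (m * x)
    rw [entries_mul] at hf
    refine (ContDiffAt.comp (entries x) hf
      (mulLeftEntries (m : Matrix ι ι ℝ)).contDiff.contDiffAt).congr_of_eventuallyEq ?_
    filter_upwards [eventually_exists_entries x] with M hM
    obtain ⟨h, rfl⟩ := hM
    rw [Function.comp_apply, ← entries_mul, extendByZero_entries, extendByZero_entries]⟩
  map_add' _ _ := rfl
  map_smul' _ _ := rfl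

theorem leftTranslate_apply (m x : Matrix.GeneralLinearGroup ι ℝ) (f : SmoothFun ι) :
    leftTranslate m f x = f (m * x) := rfl

theorem leftTranslate_mul_leftDeriv (m : Matrix.GeneralLinearGroup ι ℝ) (X : Matrix ι ι ℝ) :
    (leftTranslate m * leftDeriv X : Module.End ℂ (SmoothFun ι)) =
      leftDeriv ((m⁻¹ : Matrix.GeneralLinearGroup ι ℝ) * X * m : Matrix ι ι ℝ) *
        leftTranslate m := by
  refine LinearMap.ext fun f => SmoothFun.ext fun g => ?_
  change deriv (fun t : ℝ => f (expGL (-(t • X)) * (m * g))) 0 = deriv (fun t : ℝ =>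
    f (m * (expGL (-(t • ((m⁻¹ : Matrix.GeneralLinearGroup ι ℝ) * X * m : Matrix ι ι ℝ))) * g))) 0
  congr 1
  funext t
  rw [← mul_assoc, ← mul_assoc]
  refine congrArg (fun z => f (z * g)) (Units.ext ?_)
  have h : -(t • ((m⁻¹ : Matrix.GeneralLinearGroup ι ℝ) * X * m : Matrix ι ι ℝ)) =
      ((m⁻¹ : Matrix.GeneralLinearGroup ι ℝ) : Matrix ι ι ℝ) * (-(t • X)) * m := by
    simp
  have h' := Matrix.exp_units_conj' m (-(t • X))
  rw [← h] at h'
  rw [Units.val_mul, Units.val_mul]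
  change _ = (m : Matrix ι ι ℝ) * NormedSpace.exp _
  rw [h', ← mul_assoc, ← mul_assoc, Units.mul_inv, one_mul]
  rfl

theorem commute_leftDeriv_rightTranslate (X : Matrix ι ι ℝ) (g : Matrix.GeneralLinearGroup ι ℝ) :
    Commute (leftDeriv X : Module.End ℂ (SmoothFun ι)) (rightTranslate g) := by
  refine LinearMap.ext fun f => SmoothFun.ext fun x => ?_
  change deriv (fun t : ℝ => f (expGL (-(t • X)) * x * g)) 0 =
    deriv (fun t : ℝ => f (expGL (-(t • X)) * (x * g))) 0
  simp only [mul_assoc]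

/-- `L_X f` may be computed along `1 - t X` instead of `exp (-t X)`. The extension by zero accounts
for the `t` at which `1 - t X` is not invertible. -/
theorem hasDerivAt_extendByZero_line (X : Matrix ι ι ℝ) (f : SmoothFun ι)
    (g : Matrix.GeneralLinearGroup ι ℝ) :
    HasDerivAt (fun t : ℝ => extendByZero f (mulLeftEntries (1 - t • X) (entries g)))
      (leftDeriv X f g) 0 := by
  have h0 : mulLeftEntries (1 - (0 : ℝ) • X) (entries g) = entries g := by
    rw [zero_smul, sub_zero, mulLeftEntries_one]
  have hline : HasDerivAt (fun t : ℝ => mulLeftEntries (1 - t • X) (entries g))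
      (mulLeftEntries (-X) (entries g)) 0 := by
    have h := ((hasDerivAt_id (0 : ℝ)).smul_const (mulLeftEntries (-X) (entries g))).const_add
      (entries g)
    rw [one_smul] at h
    refine h.congr_of_eventuallyEq (Filter.Eventually.of_forall fun t => ?_)
    change mulLeftEntries (1 - t • X) (entries g) =
      entries g + t • mulLeftEntries (-X) (entries g)
    rw [← mulLeftEntries_smul, sub_eq_add_neg, ← smul_neg, mulLeftEntries_add, mulLeftEntries_one]
  have hF : HasFDerivAt (extendByZero f) (fderiv ℝ (extendByZero f) (entries g))
      (mulLeftEntries (1 - (0 : ℝ) • X) (entries g)) := by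
    rw [h0]
    exact ((f.2 g).differentiableAt (by simp)).hasFDerivAt
  rw [leftDeriv_apply]
  exact hF.comp_hasDerivAt (0 : ℝ) hline

theorem eventually_exists_eq_one_sub_smul (X : Matrix ι ι ℝ) :
    ∀ᶠ t in nhds (0 : ℝ), ∃ p : Matrix.GeneralLinearGroup ι ℝ,
      (p : Matrix ι ι ℝ) = 1 - t • X := by
  have h : Filter.Tendsto (fun t : ℝ => (1 - t • X : Matrix ι ι ℝ)) (nhds 0)
      (nhds (entries (1 : Matrix.GeneralLinearGroup ι ℝ))) := by
    have hc : Continuous (fun t : ℝ => (1 - t • X : Matrix ι ι ℝ)) := by fun_prop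
    have := hc.tendsto 0
    rwa [zero_smul, sub_zero] at this
  filter_upwards [h.eventually (eventually_exists_entries 1)] with t ht
  obtain ⟨p, hp⟩ := ht
  exact ⟨p, hp⟩

/-- If left translation by `1 - t X` multiplies `f` by `φ t` for small `t`, then `f` is an
eigenvector of `L_X` with eigenvalue `φ' 0`. -/
theorem leftDeriv_apply_eq_of_eventually {X : Matrix ι ι ℝ} {f : SmoothFun ι} {φ : ℝ → ℂ} {c : ℂ}
    (hφ : HasDerivAt φ c 0)
    (h : ∀ᶠ t in nhds (0 : ℝ), ∀ p : Matrix.GeneralLinearGroup ι ℝ,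
      (p : Matrix ι ι ℝ) = 1 - t • X → ∀ x, f (p * x) = φ t * f x) :
    leftDeriv X f = c • f := by
  refine SmoothFun.ext fun x => ?_
  refine (hasDerivAt_extendByZero_line X f x).unique
    ((hφ.mul_const (f x)).congr_of_eventuallyEq ?_)
  filter_upwards [h, eventually_exists_eq_one_sub_smul X] with t ht hp
  obtain ⟨p, hp⟩ := hp
  rw [← hp, ← entries_mul, extendByZero_entries, ht p hp]

/-- For `X` of square zero, `1 - t X` runs through a one-parameter group, so a function killed by
`L_X` is constant along it. -/
theorem apply_mul_eq_of_leftDeriv_eq_zero {X : Matrix ι ι ℝ} (hX : X * X = 0) {f : SmoothFun ι}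
    (hf : leftDeriv X f = 0) {p : Matrix.GeneralLinearGroup ι ℝ}
    (hp : (p : Matrix ι ι ℝ) = 1 - X) (x : Matrix.GeneralLinearGroup ι ℝ) : f (p * x) = f x := by
  have hmul : ∀ s t : ℝ, (1 - s • X) * (1 - t • X) = 1 - (s + t) • X := by
    intro s t
    rw [sub_mul, mul_sub, mul_sub, smul_mul_smul_comm, hX, add_smul]
    simp
    abel
  let q : ℝ → Matrix.GeneralLinearGroup ι ℝ := fun t =>
    ⟨1 - t • X, 1 - (-t) • X, by rw [hmul]; simp, by rw [hmul]; simp⟩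
  have hderiv : ∀ t : ℝ, HasDerivAt (fun t => f (q t * x)) 0 t := by
    intro t
    have h := hasDerivAt_extendByZero_line X f (q t * x)
    rw [hf] at h
    have h' := HasDerivAt.comp_sub_const t t (by rwa [sub_self])
    refine h'.congr_of_eventuallyEq (Filter.Eventually.of_forall fun s => ?_)
    have hs : mulLeftEntries (1 - (s - t) • X) (entries (q t * x)) = entries (q s * x) := by
      rw [entries_mul, entries_mul, mulLeftEntries_mulLeftEntries]
      congr 2
      change (1 - (s - t) • X) * (1 - t • X) = 1 - s • X
      rw [hmul, sub_add_cancel]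
    simp only [hs, extendByZero_entries]
  have h := is_const_of_deriv_eq_zero (fun t => (hderiv t).differentiableAt)
    (fun t => (hderiv t).deriv) 1 0
  have h1 : q 1 = p := Units.ext (by rw [hp]; change 1 - (1 : ℝ) • X = _; rw [one_smul])
  have h0 : q 0 = 1 := Units.ext (by change 1 - (0 : ℝ) • X = _; simp)
  simpa [h1, h0] using h

end LeftDeriv

/-! ### Continuity -/

section Continuity

variable {ι : Type} [Fintype ι] [DecidableEq ι]

/-- The map `f ↦ L_{X₁} ⋯ L_{Xₙ} f` into functions with the topology of uniform convergence on
compact sets. -/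
def leftDerivsOnCompacts (l : List (Matrix ι ι ℝ)) : SmoothFun ι →ₗ[ℂ]
    UniformOnFun (Matrix.GeneralLinearGroup ι ℝ) ℂ
      {K : Set (Matrix.GeneralLinearGroup ι ℝ) | IsCompact K} where
  toFun f := UniformOnFun.ofFun {K : Set (Matrix.GeneralLinearGroup ι ℝ) | IsCompact K}
    (((l.map leftDeriv).prod : Module.End ℂ (SmoothFun ι)) f :
          Matrix.GeneralLinearGroup ι ℝ → ℂ)
  map_add' f h := by rw [map_add]; rfl
  map_smul' c f := by rw [map_smul]; rfl

/-- Continuity into the Fréchet space of smooth functions is continuity of all left derivatives,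
uniformly on compact sets. -/
theorem continuous_smoothFun_iff {Y : Type*} [TopologicalSpace Y] {F : Y → SmoothFun ι} :
    Continuous F ↔ ∀ l : List (Matrix ι ι ℝ), Continuous fun y => leftDerivsOnCompacts l (F y) := by
  rw [continuous_iInf_rng]
  refine forall_congr' fun l => ?_
  rw [continuous_induced_rng]
  rfl

theorem continuous_leftDerivsOnCompacts (l : List (Matrix ι ι ℝ)) :
    Continuous (leftDerivsOnCompacts l) :=
  continuous_smoothFun_iff.1 continuous_id l

instance : ContinuousAdd (SmoothFun ι) :=
  ⟨continuous_smoothFun_iff.2 fun l => by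
    simp only [map_add]
    exact ((continuous_leftDerivsOnCompacts l).comp continuous_fst).add
      ((continuous_leftDerivsOnCompacts l).comp continuous_snd)⟩

instance : ContinuousConstSMul ℂ (SmoothFun ι) :=
  ⟨fun c => continuous_smoothFun_iff.2 fun l => by
    simp only [map_smul]
    exact (continuous_leftDerivsOnCompacts l).const_smul c⟩

theorem continuous_leftDeriv (X : Matrix ι ι ℝ) : Continuous (leftDeriv X) := by
  refine continuous_smoothFun_iff.2 fun l => ?_
  -- Each defining map of the topology, composed with `L_X`, is another one.
  have h : ∀ f, leftDerivsOnCompacts l (leftDeriv X f) = leftDerivsOnCompacts (l ++ [X]) f := by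
    intro f
    simp [leftDerivsOnCompacts]
  simp only [h]
  exact continuous_leftDerivsOnCompacts _

theorem continuous_list_prod_end (l : List (Module.End ℂ (SmoothFun ι)))
    (hl : ∀ T ∈ l, Continuous T) : Continuous l.prod := by
  induction l with
  | nil => exact continuous_id
  | cons T l ih =>
    rw [List.prod_cons]
    exact (hl T (by simp)).comp (ih fun S hS => hl S (by simp [hS]))

theorem continuous_detOperator_pow (k i : ℕ) : Continuous (detOperator k ^ i) := by
  have h : Continuous (detOperator k) := by
    have : ⇑(detOperator k) = fun f => ∑ σ : Equiv.Perm (Fin k), ((Equiv.Perm.sign σ : ℤ) : ℂ) •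
        (List.ofFn fun c : Fin k => (leftDeriv (lowerUnit k (σ c) c) :
          Module.End ℂ (SmoothFun (Fin k ⊕ Fin k)))).prod f := by
      funext f
      simp [detOperator, LinearMap.sum_apply]
    rw [this]
    refine continuous_finsetSum _ fun σ _ => ?_
    refine (continuous_list_prod_end (List.ofFn fun c : Fin k => (leftDeriv (lowerUnit k (σ c) c) :
      Module.End ℂ (SmoothFun (Fin k ⊕ Fin k)))) fun T hT => ?_).const_smul
      ((Equiv.Perm.sign σ : ℤ) : ℂ)
    obtain ⟨c, rfl⟩ := (List.mem_ofFn' _ _).1 hT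
    exact continuous_leftDeriv _
  rw [← List.prod_replicate]
  refine continuous_list_prod_end _ fun T hT => ?_
  rw [List.eq_of_mem_replicate hT]
  exact h

end Continuity

/-! ### Equivariance of the image -/

section Equivariance

open MvPolynomial

theorem leftDeriv_single_mul {ι : Type} [Fintype ι] [DecidableEq ι] (a b c d : ι) :
    (leftDeriv (Matrix.single a b 1) * leftDeriv (Matrix.single c d 1) :
      Module.End ℂ (SmoothFun ι)) =
      leftDeriv (Matrix.single c d 1) * leftDeriv (Matrix.single a b 1) +
        (if b = c then leftDeriv (Matrix.single a d 1) else 0) -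
        if d = a then leftDeriv (Matrix.single c b 1) else 0 := by
  have hmul : ∀ a b c d : ι, leftDeriv (Matrix.single a b 1 * Matrix.single c d 1) =
      if b = c then leftDeriv (Matrix.single a d 1) else 0 := by
    intro a b c d
    split_ifs with h
    · subst h
      rw [Matrix.single_mul_single_same, one_mul]
    · rw [Matrix.single_mul_single_of_ne _ _ _ _ h, leftDeriv_zero]
  have hsub : ∀ X Y : Matrix ι ι ℝ, leftDeriv (X - Y) = leftDeriv X - leftDeriv Y := by
    intro X Y
    rw [eq_sub_iff_add_eq, ← leftDeriv_add, sub_add_cancel]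
  rw [add_sub_assoc, ← hmul, ← hmul, ← hsub, ← leftDeriv_mul_sub_mul]
  abel

/-- The operator `D` is the value at the generic determinant of a homomorphism that sends the
variables to the derivatives along the opposite nilradical. -/
theorem exists_algHom_detOperator_eq (k : ℕ) :
    ∃ Ψ : MvPolynomial (Fin k × Fin k) ℂ →ₐ[ℂ] Module.End ℂ (SmoothFun (Fin k ⊕ Fin k)),
      (∀ r c, Ψ (X (r, c)) = leftDeriv (lowerUnit k r c)) ∧
      detOperator k = Ψ (Matrix.mvPolynomialX (Fin k) (Fin k) ℂ).det := by
  obtain ⟨Ψ, hΨ⟩ := exists_algHom_of_commute (R := ℂ)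
    (fun v : Fin k × Fin k => (leftDeriv (lowerUnit k v.1 v.2) :
      Module.End ℂ (SmoothFun (Fin k ⊕ Fin k)))) (by
      intro v w
      have h := leftDeriv_single_mul (Sum.inr v.1 : Fin k ⊕ Fin k) (Sum.inl v.2)
        (Sum.inr w.1) (Sum.inl w.2)
      simp only [reduceCtorEq, if_false, add_zero, sub_zero] at h
      exact h)
  refine ⟨Ψ, fun r c => hΨ (r, c), ?_⟩
  rw [detOperator, Matrix.det_apply, map_sum]
  refine Finset.sum_congr rfl fun σ _ => ?_
  rw [Units.smul_def, map_zsmul, ← Int.cast_smul_eq_zsmul ℂ, ← List.prod_ofFn, map_list_prod,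
    List.map_ofFn]
  congr 3
  funext c
  exact (hΨ (σ c, c)).symm

theorem mul_algHom_apply_of_intertwine {σ V : Type*} [AddCommGroup V] [Module ℂ V]
    (Ψ : MvPolynomial σ ℂ →ₐ[ℂ] Module.End ℂ V) (T : Module.End ℂ V)
    (ξ : σ → MvPolynomial σ ℂ) (hT : ∀ v, T * Ψ (X v) = Ψ (ξ v) * T) (Q : MvPolynomial σ ℂ) :
    T * Ψ Q = Ψ (aeval ξ Q) * T := by
  induction Q using MvPolynomial.induction_on with
  | C a =>
    rw [show Ψ (C a) = algebraMap ℂ _ a from Ψ.commutes a, aeval_C, Ψ.commutes]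
    exact (Algebra.commutes a T).symm
  | add p q hp hq => rw [map_add, mul_add, hp, hq, map_add, map_add, add_mul]
  | mul_X p v hp =>
    rw [map_mul, ← mul_assoc, hp, mul_assoc, hT, map_mul, map_mul, aeval_X, mul_assoc]

theorem detChar_apply {ι : Type} [Fintype ι] [DecidableEq ι]
    (g : Matrix.GeneralLinearGroup ι ℝ) :
    ((detChar ι g : ℂˣ) : ℂ) = ((g : Matrix ι ι ℝ).det : ℂ) := rfl

theorem signChar_apply {ι : Type} [Fintype ι] [DecidableEq ι]
    (g : Matrix.GeneralLinearGroup ι ℝ) :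
    ((signChar ι g : ℂˣ) : ℂ) = ((SignType.sign (g : Matrix ι ι ℝ).det : SignType) : ℂ) := rfl

theorem hasDerivAt_det_one_sub_smul {ι : Type} [Fintype ι] [DecidableEq ι] (α : Matrix ι ι ℝ) :
    HasDerivAt (fun t : ℝ => (1 - t • α).det) (-α.trace) 0 := by
  set P := (Matrix.det (1 + (Polynomial.X : Polynomial ℝ) • α.map Polynomial.C)).divX.divX with hP
  have hdet : ∀ t : ℝ, (1 - t • α).det = 1 + α.trace * (-t) + P.eval (-t) * (-t) ^ 2 := by
    intro t
    rw [← Matrix.det_one_add_smul, neg_smul, sub_eq_add_neg]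
  have hid := (hasDerivAt_id (0 : ℝ)).neg
  have h1 : HasDerivAt (fun t : ℝ => P.eval (-t)) _ 0 :=
    HasDerivAt.comp (0 : ℝ) (P.hasDerivAt (-0)) hid
  have h := ((hid.const_mul α.trace).const_add 1).add (h1.mul (hid.pow 2))
  refine (h.congr_of_eventuallyEq (Filter.Eventually.of_forall fun t => ?_)).congr_deriv ?_
  · simpa using hdet t
  · simp

variable {k : ℕ}

/-- The Lie algebra of the parabolic subgroup acts on `1 × δ ^ i ς` from the left by the differential
of the inducing character; the sign character does not contribute. -/
theorem leftDeriv_fromBlocks_eq_smul {i : ℕ} {f : SmoothFun (Fin k ⊕ Fin k)}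
    (hf : f ∈ principalSeries (1 : Matrix.GeneralLinearGroup (Fin k) ℝ →* ℂˣ)
      (detChar (Fin k) ^ i * signChar (Fin k))) (α β γ : Matrix (Fin k) (Fin k) ℝ) :
    leftDeriv (Matrix.fromBlocks α β 0 γ) f =
      (-(k / 2 * α.trace + (i - k / 2) * γ.trace) : ℂ) • f := by
  set u : ℝ → ℝ := fun t => (1 - t • α).det with hu
  set v : ℝ → ℝ := fun t => (1 - t • γ).det with hv
  have hu0 : u 0 = 1 := by simp [hu]
  have hv0 : v 0 = 1 := by simp [hv]
  have hu' : HasDerivAt u (-α.trace) 0 := hasDerivAt_det_one_sub_smul α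
  have hv' : HasDerivAt v (-γ.trace) 0 := hasDerivAt_det_one_sub_smul γ
  have hφ : HasDerivAt (fun t => v t ^ i * Real.sqrt (u t ^ k / v t ^ k))
      (-(k / 2 * α.trace + (i - k / 2) * γ.trace)) 0 := by
    have h := (hv'.pow i).mul (((hu'.pow k).div (hv'.pow k) (by simp [hv0])).sqrt
      (by simp [hu0, hv0]))
    refine h.congr_deriv ?_
    simp [hu0, hv0]
    ring
  have hφc := hφ.ofReal_comp
  push_cast at hφc
  refine leftDeriv_apply_eq_of_eventually hφc ?_
  filter_upwards [hu'.continuousAt.eventually (lt_mem_nhds (show 0 < u 0 by simp [hu0])),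
    hv'.continuousAt.eventually (lt_mem_nhds (show 0 < v 0 by simp [hv0]))] with t hut hvt p hp x
  have h := hf p (Matrix.GeneralLinearGroup.mkOfDetNeZero (1 - t • α) hut.ne') (-(t • β))
    (Matrix.GeneralLinearGroup.mkOfDetNeZero (1 - t • γ) hvt.ne') (by
      rw [hp, ← Matrix.fromBlocks_one, Matrix.fromBlocks_smul, sub_eq_add_neg,
        Matrix.fromBlocks_neg, Matrix.fromBlocks_add]
      simp [Matrix.GeneralLinearGroup.mkOfDetNeZero, sub_eq_add_neg]) x
  rw [h]
  have hd : ((Matrix.GeneralLinearGroup.mkOfDetNeZero (1 - t • γ) hvt.ne' :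
      Matrix.GeneralLinearGroup (Fin k) ℝ) : Matrix (Fin k) (Fin k) ℝ).det = v t := rfl
  have ha : ((Matrix.GeneralLinearGroup.mkOfDetNeZero (1 - t • α) hut.ne' :
      Matrix.GeneralLinearGroup (Fin k) ℝ) : Matrix (Fin k) (Fin k) ℝ).det = u t := rfl
  rw [MonoidHom.mul_apply, MonoidHom.pow_apply, Units.val_mul, Units.val_pow_eq_pow_val,
    detChar_apply, signChar_apply, modularFunction, hd, ha, sign_pos hvt, abs_of_pos hut,
    abs_of_pos hvt]
  simp

/-- `D ^ i f` is annihilated by the nilradical of the parabolic subgroup. -/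
theorem upper_leftDeriv_detOperator_pow_eq_zero {i : ℕ} {f : SmoothFun (Fin k ⊕ Fin k)}
    (hf : f ∈ principalSeries (1 : Matrix.GeneralLinearGroup (Fin k) ℝ →* ℂˣ)
      (detChar (Fin k) ^ i * signChar (Fin k))) (b : Matrix (Fin k) (Fin k) ℝ) :
    leftDeriv (Matrix.fromBlocks 0 b 0 0) ((detOperator k ^ i) f) = 0 := by
  obtain ⟨Ψ, hΨ, hdet⟩ := exists_algHom_detOperator_eq k
  have hsingle : ∀ s t : Fin k,
      leftDeriv (Matrix.single (Sum.inl s) (Sum.inr t) 1) ((detOperator k ^ i) f) = 0 := by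
    intro s t
    rw [hdet, ← map_pow]
    refine upper_apply_det_pow_eq_zero Ψ
      (fun s c => leftDeriv (Matrix.single (Sum.inl s : Fin k ⊕ Fin k) (Sum.inl c) 1))
      (fun r t => leftDeriv (Matrix.single (Sum.inr r : Fin k ⊕ Fin k) (Sum.inr t) 1))
      (fun s t => leftDeriv (Matrix.single (Sum.inl s : Fin k ⊕ Fin k) (Sum.inr t) 1)) i f
      ?_ ?_ ?_ ?_ ?_ ?_ s t
    · intro s c p q
      simp only [hΨ, lowerUnit]
      rw [leftDeriv_single_mul]
      simp
    · intro r t p q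
      simp only [hΨ, lowerUnit]
      rw [leftDeriv_single_mul]
      simp
    · intro s t r c
      simp only [hΨ, lowerUnit]
      rw [leftDeriv_single_mul]
      simp
    · intro s c
      have h : (Matrix.single (Sum.inl s) (Sum.inl c) 1 :
          Matrix (Fin k ⊕ Fin k) (Fin k ⊕ Fin k) ℝ) =
          Matrix.fromBlocks (Matrix.single s c 1) 0 0 0 := by
        ext (_ | _) (_ | _) <;> simp [Matrix.single_apply]
      simp only [h, leftDeriv_fromBlocks_eq_smul hf]
      congr 1
      by_cases hsc : c = s
      · simp [hsc]
      · simp [hsc, Matrix.trace_single_eq_of_ne _ _ _ (Ne.symm hsc)]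
    · intro r t
      have h : (Matrix.single (Sum.inr r) (Sum.inr t) 1 :
          Matrix (Fin k ⊕ Fin k) (Fin k ⊕ Fin k) ℝ) =
          Matrix.fromBlocks 0 0 0 (Matrix.single r t 1) := by
        ext (_ | _) (_ | _) <;> simp [Matrix.single_apply]
      simp only [h, leftDeriv_fromBlocks_eq_smul hf]
      congr 1
      by_cases hsc : t = r
      · simp [hsc]
      · simp [hsc, Matrix.trace_single_eq_of_ne _ _ _ (Ne.symm hsc)]
    · intro s t
      have h : (Matrix.single (Sum.inl s) (Sum.inr t) 1 :
          Matrix (Fin k ⊕ Fin k) (Fin k ⊕ Fin k) ℝ) =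
          Matrix.fromBlocks 0 (Matrix.single s t 1) 0 0 := by
        ext (_ | _) (_ | _) <;> simp [Matrix.single_apply]
      simp [h, leftDeriv_fromBlocks_eq_smul hf]
  have hb : (Matrix.fromBlocks 0 b 0 0 : Matrix (Fin k ⊕ Fin k) (Fin k ⊕ Fin k) ℝ) =
      ∑ s, ∑ t, b s t • Matrix.single (Sum.inl s) (Sum.inr t) 1 := by
    ext (p | p) (q | q) <;> simp [Matrix.sum_apply, Matrix.single_apply, ite_and]
  rw [hb, leftDeriv_sum, LinearMap.sum_apply]
  refine Finset.sum_eq_zero fun s _ => ?_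
  rw [leftDeriv_sum, LinearMap.sum_apply]
  refine Finset.sum_eq_zero fun t _ => ?_
  rw [leftDeriv_smul, LinearMap.smul_apply, hsingle, smul_zero]

/-- The block diagonal element `diag(a, d)` of the Levi subgroup. -/
def leviElement (a d : Matrix.GeneralLinearGroup (Fin k) ℝ) :
    Matrix.GeneralLinearGroup (Fin k ⊕ Fin k) ℝ where
  val := Matrix.fromBlocks a 0 0 d
  inv := Matrix.fromBlocks (a⁻¹ : Matrix.GeneralLinearGroup (Fin k) ℝ) 0 0
    (d⁻¹ : Matrix.GeneralLinearGroup (Fin k) ℝ)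
  val_inv := by
    rw [Matrix.fromBlocks_multiply, ← Matrix.fromBlocks_one]
    simp only [Units.mul_inv, Matrix.mul_zero, Matrix.zero_mul, add_zero, zero_add]
  inv_val := by
    rw [Matrix.fromBlocks_multiply, ← Matrix.fromBlocks_one]
    simp only [Units.inv_mul, Matrix.mul_zero, Matrix.zero_mul, add_zero, zero_add]

/-- The Levi subgroup acts on the determinant of the opposite nilradical by `δ ⊗ δ⁻¹`. -/
theorem leftTranslate_leviElement_detOperator (a d : Matrix.GeneralLinearGroup (Fin k) ℝ) :
    (leftTranslate (leviElement a d) * detOperator k :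
      Module.End ℂ (SmoothFun (Fin k ⊕ Fin k))) =
      (((a : Matrix (Fin k) (Fin k) ℝ).det / (d : Matrix (Fin k) (Fin k) ℝ).det : ℝ) : ℂ) •
        (detOperator k * leftTranslate (leviElement a d)) := by
  obtain ⟨Ψ, hΨ, hdet⟩ := exists_algHom_detOperator_eq k
  set A : Matrix (Fin k) (Fin k) ℝ := a.1 with hA
  set E : Matrix (Fin k) (Fin k) ℝ := (d⁻¹ : Matrix.GeneralLinearGroup (Fin k) ℝ).1 with hE
  let cc : ℝ →+* MvPolynomial (Fin k × Fin k) ℂ := C.comp Complex.ofRealHom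
  let ξ : Fin k × Fin k → MvPolynomial (Fin k × Fin k) ℂ := fun v =>
    ((cc.mapMatrix E).transpose * Matrix.mvPolynomialX (Fin k) (Fin k) ℂ *
      (cc.mapMatrix A).transpose) v.1 v.2
  have hξ : ∀ r c, ξ (r, c) = ∑ p, ∑ q, C ((E p r * A c q : ℝ) : ℂ) * X (p, q) := by
    intro r c
    simp only [ξ, Matrix.mul_apply, Finset.sum_mul]
    rw [Finset.sum_comm]
    refine Finset.sum_congr rfl fun p _ => Finset.sum_congr rfl fun q _ => ?_
    simp [cc]
    ring
  have hconj : ∀ r c, (((leviElement a d)⁻¹ : Matrix.GeneralLinearGroup (Fin k ⊕ Fin k) ℝ) *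
      lowerUnit k r c * leviElement a d : Matrix (Fin k ⊕ Fin k) (Fin k ⊕ Fin k) ℝ) =
      ∑ p, ∑ q, (E p r * A c q) • lowerUnit k p q := by
    intro r c
    have h : lowerUnit k r c = Matrix.fromBlocks 0 0 (Matrix.single r c 1) 0 := by
      ext (_ | _) (_ | _) <;> simp [lowerUnit, Matrix.single_apply]
    have h' : ((leviElement a d)⁻¹ : Matrix.GeneralLinearGroup (Fin k ⊕ Fin k) ℝ) =
      Matrix.fromBlocks (a⁻¹ : Matrix.GeneralLinearGroup (Fin k) ℝ).1 0 0 E := rfl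
    have h'' : (leviElement a d : Matrix (Fin k ⊕ Fin k) (Fin k ⊕ Fin k) ℝ) =
      Matrix.fromBlocks A 0 0 d.1 := rfl
    rw [h, h', h'', Matrix.fromBlocks_multiply, Matrix.fromBlocks_multiply]
    ext (p | p) (q | q) <;>
      simp [Matrix.sum_apply, lowerUnit, Matrix.single_apply, ite_and, Matrix.mul_apply]
  have hint : ∀ v, (leftTranslate (leviElement a d) * Ψ (X v) : Module.End ℂ _) =
      Ψ (ξ v) * leftTranslate (leviElement a d) := by
    rintro ⟨r, c⟩
    rw [hΨ, leftTranslate_mul_leftDeriv, hconj, hξ, leftDeriv_sum, map_sum]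
    congr 1
    refine Finset.sum_congr rfl fun p _ => ?_
    rw [leftDeriv_sum, map_sum]
    refine Finset.sum_congr rfl fun q _ => ?_
    rw [leftDeriv_smul, ← smul_eq_C_mul, map_smul, hΨ]
  have hmap : aeval ξ (Matrix.mvPolynomialX (Fin k) (Fin k) ℂ).det =
      ((A.det / (d : Matrix (Fin k) (Fin k) ℝ).det : ℝ) : ℂ) •
        (Matrix.mvPolynomialX (Fin k) (Fin k) ℂ).det := by
    have h1 : (aeval ξ).mapMatrix (Matrix.mvPolynomialX (Fin k) (Fin k) ℂ) =
        (cc.mapMatrix E).transpose * Matrix.mvPolynomialX (Fin k) (Fin k) ℂ *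
          (cc.mapMatrix A).transpose := by
      ext1 r c
      rw [AlgHom.mapMatrix_apply, Matrix.map_apply, Matrix.mvPolynomialX_apply, aeval_X]
    have h2 : E.det = (d : Matrix (Fin k) (Fin k) ℝ).det⁻¹ := by
      refine eq_inv_of_mul_eq_one_left ?_
      rw [← Matrix.det_mul, hE, Units.inv_mul, Matrix.det_one]
    rw [AlgHom.map_det, h1, Matrix.det_mul, Matrix.det_mul, Matrix.det_transpose,
      Matrix.det_transpose, ← RingHom.map_det, ← RingHom.map_det, h2, smul_eq_C_mul, div_eq_mul_inv,
      Complex.ofReal_mul, C_mul]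
    simp only [cc, RingHom.comp_apply, Complex.ofRealHom_eq_coe]
    ring
  rw [hdet, mul_algHom_apply_of_intertwine Ψ _ ξ hint, hmap, map_smul, smul_mul_assoc]

theorem detOperator_pow_mem {i : ℕ} {f : SmoothFun (Fin k ⊕ Fin k)}
    (hf : f ∈ principalSeries (1 : Matrix.GeneralLinearGroup (Fin k) ℝ →* ℂˣ)
      (detChar (Fin k) ^ i * signChar (Fin k))) :
    (detOperator k ^ i) f ∈ principalSeries (detChar (Fin k) ^ i) (signChar (Fin k)) := by
  intro p a b d hp x
  have hUpow : ∀ j : ℕ, (leftTranslate (leviElement a d) * detOperator k ^ j :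
      Module.End ℂ (SmoothFun (Fin k ⊕ Fin k))) =
      (((a : Matrix (Fin k) (Fin k) ℝ).det / (d : Matrix (Fin k) (Fin k) ℝ).det : ℝ) : ℂ) ^ j •
        (detOperator k ^ j * leftTranslate (leviElement a d)) := by
    intro j
    induction j with
    | zero => simp
    | succ j ih =>
      rw [pow_succ, ← mul_assoc, ih, smul_mul_assoc, mul_assoc,
        leftTranslate_leviElement_detOperator, mul_smul_comm, smul_smul, ← mul_assoc, pow_succ]
  -- The Levi decomposition `p = diag(a, d) n`.
  set n : Matrix.GeneralLinearGroup (Fin k ⊕ Fin k) ℝ := (leviElement a d)⁻¹ * p with hn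
  have hpn : p = leviElement a d * n := by rw [hn, mul_inv_cancel_left]
  have hnval : (n : Matrix (Fin k ⊕ Fin k) (Fin k ⊕ Fin k) ℝ) = 1 - Matrix.fromBlocks 0
      (-((a⁻¹ : Matrix.GeneralLinearGroup (Fin k) ℝ).1 * b)) 0 0 := by
    have h' : ((leviElement a d)⁻¹ : Matrix.GeneralLinearGroup (Fin k ⊕ Fin k) ℝ).1 =
      Matrix.fromBlocks (a⁻¹ : Matrix.GeneralLinearGroup (Fin k) ℝ).1 0 0
        (d⁻¹ : Matrix.GeneralLinearGroup (Fin k) ℝ).1 := rfl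
    rw [hn, Units.val_mul, h', hp, Matrix.fromBlocks_multiply, ← Matrix.fromBlocks_one,
      sub_eq_add_neg, Matrix.fromBlocks_neg, Matrix.fromBlocks_add]
    simp only [Matrix.mul_zero, Matrix.zero_mul, add_zero, zero_add, neg_zero, neg_neg,
      Units.inv_mul]
  have hninv : ((detOperator k ^ i) f) (n * x) = ((detOperator k ^ i) f) x := by
    refine apply_mul_eq_of_leftDeriv_eq_zero ?_
      (upper_leftDeriv_detOperator_pow_eq_zero hf _) hnval x
    rw [Matrix.fromBlocks_multiply]
    simp
  have hlevi : leftTranslate (leviElement a d) f =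
      (((detChar (Fin k) ^ i * signChar (Fin k)) d : ℂ) *
        (Real.sqrt (modularFunction a d) : ℂ)) • f := by
    refine SmoothFun.ext fun y => ?_
    have h := hf (leviElement a d) a 0 d rfl y
    rw [leftTranslate_apply, h, SmoothFun.smul_apply]
    simp
  have h := LinearMap.congr_fun (hUpow i) f
  rw [Module.End.mul_apply, LinearMap.smul_apply, Module.End.mul_apply, hlevi, map_smul,
    smul_smul] at h
  have h' := congrArg (fun F : SmoothFun (Fin k ⊕ Fin k) => F (n * x)) h
  simp only [leftTranslate_apply, SmoothFun.smul_apply] at h'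
  rw [hpn, mul_assoc, h', hninv, MonoidHom.mul_apply, MonoidHom.pow_apply, MonoidHom.pow_apply,
    Units.val_mul, Units.val_pow_eq_pow_val, Units.val_pow_eq_pow_val, detChar_apply,
    detChar_apply]
  have hd : ((d : Matrix (Fin k) (Fin k) ℝ).det : ℂ) ≠ 0 := by
    exact_mod_cast ((Matrix.isUnit_iff_isUnit_det _).1 d.isUnit).ne_zero
  push_cast
  rw [div_pow]
  field_simp

end Equivariance

/-! ### Non-vanishing -/

section OrderOfVanishing

variable {ι : Type} [Fintype ι] [DecidableEq ι]

/-- The smooth function on `GL(ι, ℝ)` given by a function of the matrix entries. -/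
def SmoothFun.ofEntries (F : (ι → ι → ℝ) → ℂ)
    (hF : ∀ g : Matrix.GeneralLinearGroup ι ℝ, ContDiffAt ℝ ∞ F (entries g)) : SmoothFun ι :=
  ⟨fun g => F (entries g), by
    intro g
    refine (hF g).congr_of_eventuallyEq ?_
    filter_upwards [eventually_exists_entries g] with M hM
    obtain ⟨h, rfl⟩ := hM
    rw [extendByZero_entries]⟩

instance : Mul (SmoothFun ι) :=
  ⟨fun f h => SmoothFun.ofEntries (fun M => extendByZero f M * extendByZero h M)
    fun g => (f.2 g).mul (h.2 g)⟩

theorem SmoothFun.mul_apply (f h : SmoothFun ι) (g : Matrix.GeneralLinearGroup ι ℝ) :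
    (f * h) g = f g * h g := by
  change extendByZero f (entries g) * extendByZero h (entries g) = _
  rw [extendByZero_entries, extendByZero_entries]

theorem hasDerivAt_leftDeriv (X : Matrix ι ι ℝ) (f : SmoothFun ι)
    (g : Matrix.GeneralLinearGroup ι ℝ) :
    HasDerivAt (fun t : ℝ => f (expGL (-(t • X)) * g)) (leftDeriv X f g) 0 :=
  (hasDerivAt_leftTranslate X f g).differentiableAt.hasDerivAt

theorem expGL_zero_smul_mul (X : Matrix ι ι ℝ) (g : Matrix.GeneralLinearGroup ι ℝ) :
    expGL (-((0 : ℝ) • X)) * g = g := by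
  refine (congrArg (· * g) (Units.ext ?_)).trans (one_mul g)
  simp [expGL]

/-- The operator `T` lowers the order of vanishing at `1` in powers of `τ` by `j`, with leading
coefficient `c`: it maps `τ ^ (m + j) v` to `τ ^ m w`, where
`w 1 = c (m + 1) ⋯ (m + j) v 1`. -/
def LowersOrder (τ : SmoothFun ι) (T : Module.End ℂ (SmoothFun ι)) (j : ℕ) (c : ℂ) : Prop :=
  ∀ (m : ℕ) (v f : SmoothFun ι), (∀ x, f x = τ x ^ (m + j) * v x) →
    ∃ w : SmoothFun ι, (∀ x, T f x = τ x ^ m * w x) ∧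
      w 1 = c * ((m + j).factorial / m.factorial) * v 1

theorem lowersOrder_one (τ : SmoothFun ι) : LowersOrder τ 1 0 1 := by
  intro m v f hf
  have : (m.factorial : ℂ) ≠ 0 := by exact_mod_cast m.factorial_ne_zero
  exact ⟨v, hf, by simp [this]⟩

theorem LowersOrder.mul {τ : SmoothFun ι} {T S : Module.End ℂ (SmoothFun ι)} {j l : ℕ} {c d : ℂ}
    (hT : LowersOrder τ T j c) (hS : LowersOrder τ S l d) :
    LowersOrder τ (T * S) (j + l) (c * d) := by
  intro m v f hf
  obtain ⟨w, hw, hw1⟩ := hS (m + j) v f (by simpa only [add_assoc] using hf)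
  obtain ⟨w', hw', hw1'⟩ := hT m w (S f) hw
  refine ⟨w', hw', ?_⟩
  have h1 : ((m + j).factorial : ℂ) ≠ 0 := by exact_mod_cast (m + j).factorial_ne_zero
  have h2 : (m.factorial : ℂ) ≠ 0 := by exact_mod_cast m.factorial_ne_zero
  rw [hw1', hw1, ← add_assoc]
  field_simp

theorem LowersOrder.pow {τ : SmoothFun ι} {T : Module.End ℂ (SmoothFun ι)} {j : ℕ} {c : ℂ}
    (hT : LowersOrder τ T j c) (i : ℕ) : LowersOrder τ (T ^ i) (j * i) (c ^ i) := by
  induction i with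
  | zero => exact lowersOrder_one τ
  | succ i ih =>
    rw [pow_succ, pow_succ]
    exact ih.mul hT

theorem LowersOrder.sum_smul {τ : SmoothFun ι} {α : Type*} (s : Finset α) (a : α → ℂ)
    (T : α → Module.End ℂ (SmoothFun ι)) {j : ℕ} (c : α → ℂ)
    (hT : ∀ n ∈ s, LowersOrder τ (T n) j (c n)) :
    LowersOrder τ (∑ n ∈ s, a n • T n) j (∑ n ∈ s, a n * c n) := by
  intro m v f hf
  induction s using Finset.cons_induction with
  | empty =>
    refine ⟨0, fun x => ?_, ?_⟩
    · rw [Finset.sum_empty]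
      exact (mul_zero _).symm
    · rw [Finset.sum_empty, zero_mul, zero_mul]
      rfl
  | cons n s hn ih =>
    obtain ⟨w, hw, hw1⟩ := hT n (Finset.mem_cons_self n s) m v f hf
    obtain ⟨w', hw', hw1'⟩ := ih fun n hn => hT n (Finset.mem_cons_of_mem hn)
    refine ⟨a n • w + w', fun x => ?_, ?_⟩
    · rw [Finset.sum_cons, LinearMap.add_apply, LinearMap.smul_apply, SmoothFun.add_apply,
        SmoothFun.smul_apply, SmoothFun.add_apply, SmoothFun.smul_apply, hw, hw']
      ring
    · rw [Finset.sum_cons, SmoothFun.add_apply, SmoothFun.smul_apply, hw1, hw1']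
      ring

/-- The Leibniz rule for `τ ^ (m + 1) v`, where `τ` vanishes at `1`. -/
theorem lowersOrder_leftDeriv {τ : SmoothFun ι} (hτ : τ 1 = 0) (X : Matrix ι ι ℝ) :
    LowersOrder τ (leftDeriv X) 1 (leftDeriv X τ 1) := by
  intro m v f hf
  refine ⟨((m : ℂ) + 1) • (leftDeriv X τ * v) + τ * leftDeriv X v, fun x => ?_, ?_⟩
  · have h := ((hasDerivAt_leftDeriv X τ x).pow (m + 1)).mul (hasDerivAt_leftDeriv X v x)
    rw [(hasDerivAt_leftDeriv X f x).unique
      (h.congr_of_eventuallyEq (Filter.Eventually.of_forall fun t => hf _))]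
    simp only [Pi.pow_apply, expGL_zero_smul_mul, SmoothFun.add_apply, SmoothFun.smul_apply,
      SmoothFun.mul_apply, Nat.add_sub_cancel]
    push_cast
    ring
  · have h2 : (m.factorial : ℂ) ≠ 0 := by exact_mod_cast m.factorial_ne_zero
    rw [SmoothFun.add_apply, SmoothFun.smul_apply, SmoothFun.mul_apply, SmoothFun.mul_apply, hτ,
      Nat.factorial_succ]
    push_cast
    field_simp
    ring

theorem lowersOrder_list_prod {τ : SmoothFun ι} (hτ : τ 1 = 0) (l : List (Matrix ι ι ℝ)) :
    LowersOrder τ (l.map leftDeriv).prod l.length (l.map fun X => leftDeriv X τ 1).prod := by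
  induction l with
  | nil => exact lowersOrder_one τ
  | cons X l ih =>
    rw [List.map_cons, List.prod_cons, List.map_cons, List.prod_cons, List.length_cons, add_comm]
    exact (lowersOrder_leftDeriv hτ X).mul ih

/-- The leading coefficient of `D` is the determinant of the derivatives of `τ` at `1`. -/
theorem lowersOrder_detOperator {k : ℕ} {τ : SmoothFun (Fin k ⊕ Fin k)} (hτ : τ 1 = 0) :
    LowersOrder τ (detOperator k) k
      (Matrix.of fun r c : Fin k => leftDeriv (lowerUnit k r c) τ 1).det := by
  rw [Matrix.det_apply']
  refine LowersOrder.sum_smul _ _ _ _ fun σ _ => ?_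
  have h := lowersOrder_list_prod hτ (List.ofFn fun c : Fin k => lowerUnit k (σ c) c)
  rw [List.map_ofFn, List.map_ofFn, List.length_ofFn, List.prod_ofFn (f := _ ∘ _)] at h
  exact h

end OrderOfVanishing

section TestFunction

variable {k : ℕ}

theorem contDiff_det {E n : Type*} [NormedAddCommGroup E] [NormedSpace ℝ E] [Fintype n]
    [DecidableEq n] {A : E → Matrix n n ℝ} (hA : ∀ i j, ContDiff ℝ ∞ fun x => A x i j) :
    ContDiff ℝ ∞ fun x => (A x).det := by
  simp only [Matrix.det_apply']
  exact ContDiff.sum fun σ _ => contDiff_const.mul (contDiff_prod fun j _ => hA _ _)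

/-- The lower half `(C D)` of a matrix with blocks `A, B, C, D`. -/
def lowerRows (M : Fin k ⊕ Fin k → Fin k ⊕ Fin k → ℝ) : Matrix (Fin k) (Fin k ⊕ Fin k) ℝ :=
  Matrix.of fun r c => M (Sum.inr r) c

/-- `det (s C + D)` for the lower half `(C D)` of a matrix. -/
def lowerDet (s : ℝ) (M : Fin k ⊕ Fin k → Fin k ⊕ Fin k → ℝ) : ℝ :=
  (s • (lowerRows M).submatrix id Sum.inl + (lowerRows M).submatrix id Sum.inr).det

/-- `det (C Cᵀ + D Dᵀ)` for the lower half `(C D)` of a matrix. -/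
def lowerGram (M : Fin k ⊕ Fin k → Fin k ⊕ Fin k → ℝ) : ℝ :=
  (lowerRows M * (lowerRows M).transpose).det

theorem contDiff_lowerDet (s : ℝ) : ContDiff ℝ ∞ (lowerDet (k := k) s) := by
  refine contDiff_det fun i j => ?_
  change ContDiff ℝ ∞ fun M : Fin k ⊕ Fin k → Fin k ⊕ Fin k → ℝ =>
    s * M (Sum.inr i) (Sum.inl j) + M (Sum.inr i) (Sum.inr j)
  fun_prop

theorem contDiff_lowerGram : ContDiff ℝ ∞ (lowerGram (k := k)) := by
  refine contDiff_det fun i j => ?_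
  simp only [Matrix.mul_apply, Matrix.transpose_apply, lowerRows, Matrix.of_apply]
  fun_prop

theorem lowerGram_pos (g : Matrix.GeneralLinearGroup (Fin k ⊕ Fin k) ℝ) :
    0 < lowerGram (entries g) := by
  refine Matrix.PosDef.det_pos ?_
  rw [← Matrix.conjTranspose_eq_transpose_of_trivial]
  refine Matrix.PosDef.mul_conjTranspose_self _ ?_
  intro v w hvw
  -- The rows of `(C D)` are rows of an invertible matrix, hence linearly independent.
  have hext : ∀ v : Fin k → ℝ, Matrix.vecMul (Sum.elim 0 v) g.1 =
      Matrix.vecMul v (lowerRows (entries g)) := by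
    intro v
    funext c
    simp [Matrix.vecMul, dotProduct, lowerRows, entries]
  have h := hvw
  simp only [← hext] at h
  have h2 := Matrix.vecMul_injective_of_isUnit g.isUnit h
  funext r
  exact congrFun h2 (Sum.inr r)

theorem lowerRows_entries_mul {p : Matrix.GeneralLinearGroup (Fin k ⊕ Fin k) ℝ}
    {a b d : Matrix (Fin k) (Fin k) ℝ} (hp : p.1 = Matrix.fromBlocks a b 0 d)
    (x : Matrix.GeneralLinearGroup (Fin k ⊕ Fin k) ℝ) :
    lowerRows (entries (p * x)) = d * lowerRows (entries x) := by
  ext r c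
  simp [lowerRows, entries, hp, Matrix.mul_apply]

theorem lowerDet_entries_mul {p : Matrix.GeneralLinearGroup (Fin k ⊕ Fin k) ℝ}
    {a b d : Matrix (Fin k) (Fin k) ℝ} (hp : p.1 = Matrix.fromBlocks a b 0 d)
    (x : Matrix.GeneralLinearGroup (Fin k ⊕ Fin k) ℝ) (s : ℝ) :
    lowerDet s (entries (p * x)) = d.det * lowerDet s (entries x) := by
  rw [lowerDet, lowerDet, lowerRows_entries_mul hp, ← Matrix.det_mul, Matrix.mul_add,
    Matrix.mul_smul]
  rfl

theorem lowerGram_entries_mul {p : Matrix.GeneralLinearGroup (Fin k ⊕ Fin k) ℝ}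
    {a b d : Matrix (Fin k) (Fin k) ℝ} (hp : p.1 = Matrix.fromBlocks a b 0 d)
    (x : Matrix.GeneralLinearGroup (Fin k ⊕ Fin k) ℝ) :
    lowerGram (entries (p * x)) = d.det ^ 2 * lowerGram (entries x) := by
  rw [lowerGram, lowerGram, lowerRows_entries_mul hp, Matrix.transpose_mul, Matrix.mul_assoc,
    Matrix.det_mul, ← Matrix.mul_assoc, Matrix.det_mul, Matrix.det_transpose]
  ring

/-- The function `det (C + D) - det D` of the lower half `(C D)`. It vanishes at `1`, its derivative
there in the direction of the opposite nilradical is the trace, and it transforms under left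
translation by the parabolic subgroup by `det d`. -/
def vanishingFun (k : ℕ) : SmoothFun (Fin k ⊕ Fin k) :=
  SmoothFun.ofEntries (fun M => ((lowerDet 1 M - lowerDet 0 M : ℝ) : ℂ)) fun _ =>
    Complex.ofRealCLM.contDiff.comp_contDiffAt _
      ((contDiff_lowerDet 1).sub (contDiff_lowerDet 0)).contDiffAt

theorem vanishingFun_apply (g : Matrix.GeneralLinearGroup (Fin k ⊕ Fin k) ℝ) :
    vanishingFun k g = ((lowerDet 1 (entries g) - lowerDet 0 (entries g) : ℝ) : ℂ) := rfl

theorem lowerDet_eq_of_fromBlocks {p : Matrix.GeneralLinearGroup (Fin k ⊕ Fin k) ℝ}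
    {a b c d : Matrix (Fin k) (Fin k) ℝ} (hp : p.1 = Matrix.fromBlocks a b c d)
    (s : ℝ) : lowerDet s (entries p) = (s • c + d).det := by
  rw [lowerDet]
  congr 1
  ext r q
  simp [lowerRows, entries, hp]

theorem vanishingFun_one : vanishingFun k 1 = 0 := by
  have h : (1 : Matrix.GeneralLinearGroup (Fin k ⊕ Fin k) ℝ).1 =
      Matrix.fromBlocks 1 0 0 1 := Matrix.fromBlocks_one.symm
  rw [vanishingFun_apply, lowerDet_eq_of_fromBlocks h, lowerDet_eq_of_fromBlocks h]
  simp

theorem leftDeriv_lowerUnit_vanishingFun (r c : Fin k) :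
    leftDeriv (lowerUnit k r c) (vanishingFun k) 1 = -(1 : Matrix (Fin k) (Fin k) ℂ) r c := by
  have hX : lowerUnit k r c = Matrix.fromBlocks 0 0 (Matrix.single r c 1) 0 := by
    ext (_ | _) (_ | _) <;> simp [lowerUnit, Matrix.single_apply]
  have hd := ((hasDerivAt_det_one_sub_smul (Matrix.single r c (1 : ℝ))).sub_const 1).ofReal_comp
  have htrace : ((-(Matrix.single r c (1 : ℝ)).trace : ℝ) : ℂ) =
      -(1 : Matrix (Fin k) (Fin k) ℂ) r c := by
    by_cases h : r = c
    · subst h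
      simp
    · simp [h, Matrix.trace_single_eq_of_ne _ _ _ h]
  rw [htrace] at hd
  refine (hasDerivAt_extendByZero_line _ _ 1).unique (hd.congr_of_eventuallyEq ?_)
  filter_upwards [eventually_exists_eq_one_sub_smul (lowerUnit k r c)] with t hp
  obtain ⟨p, hp⟩ := hp
  rw [← hp, ← entries_mul, extendByZero_entries, mul_one]
  rw [hX, ← Matrix.fromBlocks_one, Matrix.fromBlocks_smul, sub_eq_add_neg, Matrix.fromBlocks_neg,
    Matrix.fromBlocks_add] at hp
  rw [vanishingFun_apply, lowerDet_eq_of_fromBlocks hp, lowerDet_eq_of_fromBlocks hp]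
  simp [sub_eq_add_neg, add_comm]

/-- The factor `|det x| ^ (k / 2) (det D) ^ N det (C Cᵀ + D Dᵀ) ^ (- n / 2)`, smooth and without
zeros near `1`. -/
def equivariantFactor (k N n : ℕ) : SmoothFun (Fin k ⊕ Fin k) :=
  SmoothFun.ofEntries (fun M => ((Real.sqrt (|(Matrix.of M).det| ^ k) * lowerDet 0 M ^ N /
    Real.sqrt (lowerGram M) ^ n : ℝ) : ℂ)) fun g => by
      have hdet : (Matrix.of (entries g)).det ≠ 0 :=
        ((Matrix.isUnit_iff_isUnit_det _).1 g.isUnit).ne_zero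
      have h1 : ContDiffAt ℝ ∞ (fun M : Fin k ⊕ Fin k → Fin k ⊕ Fin k → ℝ =>
          |(Matrix.of M).det|) (entries g) :=
        ContDiffAt.comp (entries g) (contDiffAt_abs hdet)
          (contDiff_det fun i j => by
            change ContDiff ℝ ∞ fun M : Fin k ⊕ Fin k → Fin k ⊕ Fin k → ℝ => M i j
            fun_prop).contDiffAt
      have h2 := (h1.pow k).sqrt (pow_ne_zero k (abs_ne_zero.2 hdet))
      have h3 := (contDiff_lowerGram (k := k)).contDiffAt.sqrt (lowerGram_pos g).ne'
      exact Complex.ofRealCLM.contDiff.comp_contDiffAt _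
        ((h2.mul ((contDiff_lowerDet 0).contDiffAt.pow N)).div (h3.pow n)
          (pow_ne_zero n (Real.sqrt_pos.2 (lowerGram_pos g)).ne'))

theorem equivariantFactor_apply (N n : ℕ) (g : Matrix.GeneralLinearGroup (Fin k ⊕ Fin k) ℝ) :
    equivariantFactor k N n g = ((Real.sqrt (|g.1.det| ^ k) *
      lowerDet 0 (entries g) ^ N / Real.sqrt (lowerGram (entries g)) ^ n : ℝ) : ℂ) := rfl

/-- The scalar identity behind the equivariance of the test function. -/
theorem equivariance_scalar (k i : ℕ) {α δ ξ H : ℝ} (hδ : δ ≠ 0) :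
    δ ^ (k * i) * (Real.sqrt (|α * δ * ξ| ^ k) * δ ^ (k * i + i + 1) /
        Real.sqrt (δ ^ 2 * H) ^ (2 * (k * i) + k + 1)) =
      δ ^ i * (SignType.sign δ : ℝ) * Real.sqrt (|α| ^ k / |δ| ^ k) *
        (Real.sqrt (|ξ| ^ k) / Real.sqrt H ^ (2 * (k * i) + k + 1)) := by
  have hδ' : 0 < |δ| := abs_pos.2 hδ
  have h1 : Real.sqrt (δ ^ 2 * H) = |δ| * Real.sqrt H := by
    rw [Real.sqrt_mul (sq_nonneg δ), Real.sqrt_sq_eq_abs]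
  have h2 : Real.sqrt (|α * δ * ξ| ^ k) =
      |δ| ^ k * Real.sqrt (|α| ^ k / |δ| ^ k) * Real.sqrt (|ξ| ^ k) := by
    have : |α * δ * ξ| ^ k = (|δ| ^ k) ^ 2 * (|α| ^ k / |δ| ^ k) * |ξ| ^ k := by
      rw [abs_mul, abs_mul, mul_pow, mul_pow]
      field_simp
    rw [this, Real.sqrt_mul (by positivity), Real.sqrt_mul (by positivity),
      Real.sqrt_sq (by positivity)]
  have h3 : δ ^ (k * i) * δ ^ (k * i + i + 1) =
      |δ| ^ (2 * (k * i) + 1) * (δ ^ i * (SignType.sign δ : ℝ)) := by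
    have hs : (SignType.sign δ : ℝ) * |δ| = δ := sign_mul_abs δ
    have he : |δ| ^ (2 * (k * i)) = δ ^ (2 * (k * i)) := by
      rw [pow_mul |δ| 2, sq_abs, ← pow_mul]
    rw [pow_succ |δ|, he]
    linear_combination -δ ^ (2 * (k * i)) * δ ^ i * hs
  calc _ = (δ ^ (k * i) * δ ^ (k * i + i + 1)) * (Real.sqrt (|α * δ * ξ| ^ k) /
        Real.sqrt (δ ^ 2 * H) ^ (2 * (k * i) + k + 1)) := by ring
    _ = |δ| ^ (2 * (k * i) + k + 1) / |δ| ^ (2 * (k * i) + k + 1) *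
        (δ ^ i * (SignType.sign δ : ℝ) * Real.sqrt (|α| ^ k / |δ| ^ k) *
          (Real.sqrt (|ξ| ^ k) / Real.sqrt H ^ (2 * (k * i) + k + 1))) := by
      rw [h1, h2, h3, mul_pow]
      ring
    _ = _ := by rw [div_self (pow_ne_zero _ hδ'.ne'), one_mul]

/-- The function `τ ^ (k i) v`, with `τ` and `v` the functions `vanishingFun` and
`equivariantFactor`, is in the representation, and `D ^ i` maps it to a function whose value at `1`
is `± (k i)! v 1`. -/
theorem exists_mem_principalSeries_detOperator_pow_ne_zero (k i : ℕ) :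
    ∃ f ∈ principalSeries (1 : Matrix.GeneralLinearGroup (Fin k) ℝ →* ℂˣ)
      (detChar (Fin k) ^ i * signChar (Fin k)), (detOperator k ^ i) f ≠ 0 := by
  have hpow : ∃ t : SmoothFun (Fin k ⊕ Fin k), ∀ x, t x = vanishingFun k x ^ (k * i) :=
    ⟨⟨fun x => vanishingFun k x ^ (k * i), fun g => by
      refine (((vanishingFun k).2 g).pow (k * i)).congr_of_eventuallyEq ?_
      filter_upwards [eventually_exists_entries g] with M hM
      obtain ⟨h, rfl⟩ := hM
      simp only [extendByZero_entries]⟩, fun _ => rfl⟩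
  obtain ⟨t, ht⟩ := hpow
  -- The exponents make the powers of `det d` add up to `i - k`, and the sign of `det d` occur to
  -- the power `i + 1` modulo `2`.
  set v := equivariantFactor k (k * i + i + 1) (2 * (k * i) + k + 1) with hv
  refine ⟨t * v, ?_, ?_⟩
  · intro p a b d hp x
    have hdet : (p : Matrix (Fin k ⊕ Fin k) (Fin k ⊕ Fin k) ℝ).det = a.1.det * d.1.det := by
      rw [hp, Matrix.det_fromBlocks_zero₂₁]
    have hdne : d.1.det ≠ 0 := ((Matrix.isUnit_iff_isUnit_det _).1 d.isUnit).ne_zero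
    rw [SmoothFun.mul_apply, SmoothFun.mul_apply, ht, ht, vanishingFun_apply, vanishingFun_apply,
      hv, equivariantFactor_apply, equivariantFactor_apply, lowerDet_entries_mul hp,
      lowerDet_entries_mul hp, lowerGram_entries_mul hp, MonoidHom.mul_apply, MonoidHom.pow_apply,
      Units.val_mul, Units.val_mul, Units.val_pow_eq_pow_val, detChar_apply, signChar_apply,
      modularFunction, Matrix.det_mul, hdet, Fintype.card_fin]
    have hkey := congrArg (fun r : ℝ => (r : ℂ))
      (equivariance_scalar k i (α := a.1.det) (ξ := x.1.det) (H := lowerGram (entries x)) hdne)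
    have hsign : ((SignType.sign d.1.det : SignType) : ℂ) =
        (((SignType.sign d.1.det : SignType) : ℝ) : ℂ) := by
      cases SignType.sign d.1.det <;> simp
    rw [hsign]
    simp only [MonoidHom.one_apply, Units.val_one, one_mul]
    rw [← mul_sub]
    push_cast at hkey ⊢
    rw [mul_pow (d.1.det : ℂ) _ (k * i)]
    linear_combination ((lowerDet 1 (entries x) : ℂ) - lowerDet 0 (entries x)) ^ (k * i) *
      (lowerDet 0 (entries x) : ℂ) ^ (k * i + i + 1) * hkey
  · intro h0
    obtain ⟨w, hw, hw1⟩ := (lowersOrder_detOperator vanishingFun_one).pow i 0 v (t * v)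
      (fun x => by rw [SmoothFun.mul_apply, ht, zero_add])
    have h1 := hw 1
    rw [h0, pow_zero, one_mul, hw1] at h1
    have hN : (Matrix.of fun r c : Fin k => leftDeriv (lowerUnit k r c) (vanishingFun k) 1) =
        -1 := by
      ext r c
      rw [Matrix.of_apply, leftDeriv_lowerUnit_vanishingFun, Matrix.neg_apply]
    have hblocks : (1 : Matrix.GeneralLinearGroup (Fin k ⊕ Fin k) ℝ).1 =
      Matrix.fromBlocks 1 0 0 1 := Matrix.fromBlocks_one.symm
    have hv1 : v 1 ≠ 0 := by
      rw [hv, equivariantFactor_apply, lowerDet_eq_of_fromBlocks hblocks]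
      simpa using (Real.sqrt_pos.2 (lowerGram_pos 1)).ne'
    have hne : (((k * i).factorial : ℕ) : ℂ) ≠ 0 := by exact_mod_cast (k * i).factorial_ne_zero
    rw [hN, Matrix.det_neg, Matrix.det_one, zero_add] at h1
    have h2 : ((-1 : ℂ) ^ Fintype.card (Fin k) * 1) ^ i *
        (((k * i).factorial : ℂ) / (Nat.factorial 0 : ℂ)) * v 1 ≠ 0 := by
      refine mul_ne_zero (mul_ne_zero (pow_ne_zero _ (by simp)) ?_) hv1
      simpa using hne
    exact h2 h1.symm

end TestFunction

/-! ### The intertwining operator -/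

theorem commute_detOperator_pow_rightTranslate (k i : ℕ)
    (g : Matrix.GeneralLinearGroup (Fin k ⊕ Fin k) ℝ) :
    Commute (detOperator k ^ i) (rightTranslate g) := by
  refine Commute.pow_left ?_ i
  rw [detOperator]
  refine Commute.sum_left _ _ _ fun σ _ => Commute.smul_left (Commute.list_prod_left _ _ ?_) _
  intro T hT
  obtain ⟨c, rfl⟩ := (List.mem_ofFn' _ _).1 hT
  exact commute_leftDeriv_rightTranslate _ g

end

end GrassmannianIntertwiners

open GrassmannianIntertwiners in
theorem proposition1p4 (k : ℕ) (hk : 0 < k) (i : ℕ) (hi : 0 < i) :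
    ∃ T : ↥(principalSeries (1 : Matrix.GeneralLinearGroup (Fin k) ℝ →* ℂˣ)
          (detChar (Fin k) ^ i * signChar (Fin k))) →L[ℂ]
        ↥(principalSeries (detChar (Fin k) ^ i) (signChar (Fin k))),
      (∀ (g : Matrix.GeneralLinearGroup (Fin k ⊕ Fin k) ℝ)
          (f : ↥(principalSeries (1 : Matrix.GeneralLinearGroup (Fin k) ℝ →* ℂˣ)
            (detChar (Fin k) ^ i * signChar (Fin k)))),
        T (principalSeriesRep 1 (detChar (Fin k) ^ i * signChar (Fin k)) g f) =
          principalSeriesRep (detChar (Fin k) ^ i) (signChar (Fin k)) g (T f)) ∧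
      T ≠ 0 ∧
      ∀ f, (T f : SmoothFun (Fin k ⊕ Fin k)) =
        (detOperator k ^ i) (f : SmoothFun (Fin k ⊕ Fin k)) := by
  refine ⟨⟨(detOperator k ^ i).restrict fun f hf => detOperator_pow_mem hf, ?_⟩, ?_, ?_, ?_⟩
  · exact ((continuous_detOperator_pow k i).comp continuous_subtype_val).subtype_mk _
  · intro g f
    exact Subtype.ext (LinearMap.congr_fun (commute_detOperator_pow_rightTranslate k i g).eq f.1)
  · obtain ⟨f, hf, hne⟩ := exists_mem_principalSeries_detOperator_pow_ne_zero k i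
    intro h0
    have h := congrArg Subtype.val (DFunLike.congr_fun h0
      (⟨f, hf⟩ : principalSeries (1 : Matrix.GeneralLinearGroup (Fin k) ℝ →* ℂˣ)
        (detChar (Fin k) ^ i * signChar (Fin k))))
    exact hne h
  · intro f
    rfl
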